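/- Let $\mathbb K\in\{\mathbb R,\mathbb C\}$; Banach spaces and Banach algebras (not necessarily unital) are over $\mathbb K$. Let $(A,G,\alpha)$ be a Banach algebra dynamical system: $A$ is a Banach algebra, $G$ a locally compact Hausdorff group with a fixed left Haar measure, and $\alpha$ a strongly continuous representation of $G$ on $A$ by bounded algebra automorphisms. Assume that $A$ has a bounded approximate left identity. A continuous covariant representation $(\pi,U)$ of $(A,G,\alpha)$ on a Banach space $X$ consists of a bounded representation $\pi:A\to B(X)$ and a strongly continuous representation $U:G\to B(X)$ with $\pi(\alpha_s(a))=U_s\pi(a)U_s^{-1}$. A representation $T$ of an algebra $E$ on $X$ is non-degenerate if the span of $T(E)X$ is dense in $X$; the pair $(\pi,U)$ is non-degenerate if $\pi$ is. The integrated form is $\pi\rtimes U(f)x=\int_G\pi(f(s))U_sx\,ds$ for $f\in C_c(G,A)$, $x\in X$. The space $C_c(G,A)$ is an algebra under $[f*g](s)=\int_G f(r)\alpha_r(g(r^{-1}s))\,dr$. Let $\mathcal R$ be a non-empty uniformly bounded class of non-degenerate continuous covariant representations, i.e. there are $C\ge 0$ and $\nu:G\to[0,\infty)$, bounded on compact sets,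 with $\|\pi\|\le C$ and $\|U_r\|\le\nu(r)$ for all $(\pi,U)\in\mathcal R$ and $r\in G$. Put $\sigma^{\mathcal R}(f)=\sup_{(\pi,U)\in\mathcal R}\|\pi\rtimes U(f)\|$. The crossed product $(A\rtimes_\alpha G)^{\mathcal R}$ is the Banach algebra completion of $C_c(G,A)/\ker\sigma^{\mathcal R}$, with quotient map $q^{\mathcal R}:C_c(G,A)\to(A\rtimes_\alpha G)^{\mathcal R}$. A continuous covariant representation is $\mathcal R$-continuous if its integrated form is bounded with respect to $\sigma^{\mathcal R}$. For a Banach algebra $B$ let $\mathcal M_l(B)=\{L\in B(B): L(ab)=L(a)b \text{ for all } a,b\in B\}$, with the operator norm, and let $\lambda:B\to\mathcal M_l(B)$, $\lambda(b)c=bc$. If $B$ has a bounded approximate left identity $(u_i)$, every non-degenerate bounded representation $T:B\to B(X)$ induces a bounded representation $\overline T:\mathcal M_l(B)\to B(X)$ with $\overline T\circ\lambda=T$, namely $\overline T(L)=\mathrm{SOT}\text{-}\lim_i T(Lu_i)$. Let $i_A^{\mathcal R}:A\to\mathcal M_l((A\rtimes_\alpha G)^{\mathcal R})$ and $i_G^{\mathcal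 R}:G\to\mathcal M_l((A\rtimes_\alpha G)^{\mathcal R})$ be determined by $i_A^{\mathcal R}(a)q^{\mathcal R}(f)=q^{\mathcal R}(s\mapsto af(s))$ and $i_G^{\mathcal R}(r)q^{\mathcal R}(f)=q^{\mathcal R}(s\mapsto\alpha_r(f(r^{-1}s)))$. Let $B$ be a Banach algebra with a bounded approximate left identity such that $\lambda:B\to\mathcal M_l(B)$ is a topological embedding. Let $(k_A,k_G)$ be a non-degenerate $\mathcal R$-continuous covariant representation of $(A,G,\alpha)$ on the Banach space $B$ such that 1. $k_A(A),\,k_G(G)\subseteq\mathcal M_l(B)$; 2. $(k_A\rtimes k_G)(C_c(G,A))\subseteq\lambda(B)$; 3. $(k_A\rtimes k_G)(C_c(G,A))$ is dense in $\lambda(B)$. Suppose that for each non-degenerate $\mathcal R$-continuous covariant representation $(\pi,U)$ of $(A,G,\alpha)$ on a Banach space $X$ there is a non-degenerate bounded representation $T:B\to B(X)$ with $\overline T\circ k_A=\pi$ and $\overline T\circ k_G=U$. Then there exists a unique topological isomorphism of Banach algebras $\psi:(A\rtimes_\alpha G)^{\mathcal R}\to B$ such that the induced topological isomorphism $\psi_l:\mathcal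 M_l((A\rtimes_\alpha G)^{\mathcal R})\to\mathcal M_l(B)$, $\psi_l(L)=\psi L\psi^{-1}$, satisfies $k_A=\psi_l\circ i_A^{\mathcal R}$ and $k_G=\psi_l\circ i_G^{\mathcal R}$. -/

import Mathlib

open MeasureTheory Filter Topology
open scoped CompactlySupported

set_option linter.unusedSectionVars false

universe u v w x

noncomputable section

namespace BanachCrossedProduct

/-! ### Strongly continuous representations and vector-valued integrals -/

section Integral

variable (𝕜 : Type*) [RCLike 𝕜] {G : Type*} [MeasurableSpace G] (μ : Measure G)
  {E : Type*} [NormedAddCommGroup E] [NormedSpace 𝕜 E]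

/-- The integral of a function with values in a Banach space over `𝕜` (`ℝ` or `ℂ`), viewed as a
real Banach space by restriction of scalars. -/
def vint (f : G → E) : E :=
  letI : NormedSpace ℝ E := NormedSpace.restrictScalars ℝ 𝕜 E
  ∫ s, f s ∂μ

variable {𝕜 μ}

theorem norm_vint_le (f : G → E) : ‖vint 𝕜 μ f‖ ≤ ∫ s, ‖f s‖ ∂μ := by
  let _ : NormedSpace ℝ E := NormedSpace.restrictScalars ℝ 𝕜 E
  exact norm_integral_le_integral_norm f

theorem vint_congr {f g : G → E} (h : ∀ s, f s = g s) : vint 𝕜 μ f = vint 𝕜 μ g := by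
  rw [show f = g from funext h]

theorem vint_zero : vint 𝕜 μ (fun _ => (0 : E)) = 0 := by
  let _ : NormedSpace ℝ E := NormedSpace.restrictScalars ℝ 𝕜 E
  exact integral_zero G E

variable [TopologicalSpace G] [BorelSpace G] [IsFiniteMeasureOnCompacts μ]

theorem vint_add {f g : G → E} (hf : Continuous f) (hf' : HasCompactSupport f)
    (hg : Continuous g) (hg' : HasCompactSupport g) :
    vint 𝕜 μ (fun s => f s + g s) = vint 𝕜 μ f + vint 𝕜 μ g := by
  let _ : NormedSpace ℝ E := NormedSpace.restrictScalars ℝ 𝕜 E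
  exact integral_add (hf.integrable_of_hasCompactSupport hf')
    (hg.integrable_of_hasCompactSupport hg')

theorem clm_vint [CompleteSpace E] {F : Type*} [NormedAddCommGroup F] [NormedSpace 𝕜 F]
    [CompleteSpace F] (L : E →L[𝕜] F) {f : G → E} (hf : Continuous f)
    (hf' : HasCompactSupport f) : L (vint 𝕜 μ f) = vint 𝕜 μ (fun s => L (f s)) := by
  let _ : NormedSpace ℝ E := NormedSpace.restrictScalars ℝ 𝕜 E
  let _ : NormedSpace ℝ F := NormedSpace.restrictScalars ℝ 𝕜 F
  exact (L.integral_comp_comm (hf.integrable_of_hasCompactSupport hf')).symm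

theorem vint_swap {f : G → G → E} (hf : Continuous f.uncurry)
    (hf' : HasCompactSupport f.uncurry) :
    vint 𝕜 μ (fun s => vint 𝕜 μ (fun r => f s r)) =
      vint 𝕜 μ (fun r => vint 𝕜 μ (fun s => f s r)) := by
  let _ : NormedSpace ℝ E := NormedSpace.restrictScalars ℝ 𝕜 E
  exact integral_integral_swap_of_hasCompactSupport hf hf'

theorem continuous_vint {X : Type*} [TopologicalSpace X] {f : X → G → E} {K : Set G}
    (hK : IsCompact K) (hf : Continuous f.uncurry) (hf' : ∀ p x, x ∉ K → f p x = 0) :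
    Continuous (fun p => vint 𝕜 μ (f p)) := by
  let _ : NormedSpace ℝ E := NormedSpace.restrictScalars ℝ 𝕜 E
  rw [← continuousOn_univ]
  exact continuousOn_integral_of_compact_support hK hf.continuousOn (fun p x _ h => hf' p x h)

theorem vint_mul_left [Group G] [IsTopologicalGroup G] [μ.IsMulLeftInvariant] (f : G → E) (r : G) :
    vint 𝕜 μ (fun s => f (r * s)) = vint 𝕜 μ f := by
  let _ : NormedSpace ℝ E := NormedSpace.restrictScalars ℝ 𝕜 E
  exact integral_mul_left_eq_self f r

end Integral

section StronglyContinuous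

variable {𝕜 : Type*} [RCLike 𝕜] {G : Type*} [Monoid G] [TopologicalSpace G]
  {E : Type*} [NormedAddCommGroup E] [NormedSpace 𝕜 E] [CompleteSpace E]

theorem exists_bound_on_compact (V : G →* (E →L[𝕜] E)) (hV : ∀ x, Continuous fun r => V r x)
    {K : Set G} (hK : IsCompact K) : ∃ C, 0 ≤ C ∧ ∀ r ∈ K, ‖V r‖ ≤ C := by
  obtain ⟨C, hC⟩ := banach_steinhaus (g := fun r : K => V r) (fun x => by
    obtain ⟨c, hc⟩ := hK.exists_bound_of_continuousOn (hV x).continuousOn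
    exact ⟨c, fun r => hc r r.2⟩)
  exact ⟨max C 0, le_max_right _ _, fun r hr => (hC ⟨r, hr⟩).trans (le_max_left _ _)⟩

theorem continuous_uncurry_rep [LocallyCompactSpace G] (V : G →* (E →L[𝕜] E))
    (hV : ∀ x, Continuous fun r => V r x) : Continuous fun p : G × E => V p.1 p.2 := by
  rw [continuous_iff_continuousAt]
  rintro ⟨r₀, x₀⟩
  obtain ⟨K, hK, hKr⟩ := exists_compact_mem_nhds r₀
  obtain ⟨C, hC0, hC⟩ := exists_bound_on_compact V hV hK
  have h1 : Tendsto (fun p : G × E => V p.1 (p.2 - x₀)) (𝓝 (r₀, x₀)) (𝓝 0) := by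
    have h2 : Tendsto (fun p : G × E => C * ‖p.2 - x₀‖) (𝓝 (r₀, x₀)) (𝓝 0) := by
      have : Continuous fun p : G × E => C * ‖p.2 - x₀‖ := by fun_prop
      simpa using this.tendsto (r₀, x₀)
    refine squeeze_zero_norm' ?_ h2
    filter_upwards [continuous_fst.continuousAt.preimage_mem_nhds hKr] with p hp
    exact (V p.1).le_of_opNorm_le (hC _ hp) _
  have h3 : Tendsto (fun p : G × E => V p.1 x₀) (𝓝 (r₀, x₀)) (𝓝 (V r₀ x₀)) :=
    ((hV x₀).comp continuous_fst).tendsto (r₀, x₀)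
  have := h1.add h3
  simpa [ContinuousAt] using this

end StronglyContinuous

/-! ### Banach algebra dynamical systems, twisted convolution -/

/-- A Banach algebra dynamical system `(A, G, α)`: a strongly continuous representation of `G` on
`A` by bounded algebra automorphisms. (Each `act r` is invertible since `act` is a homomorphism on
a group.) -/
structure DynamicalSystem (𝕜 : Type*) [RCLike 𝕜] (A : Type u) [NonUnitalNormedRing A]
    [NormedSpace 𝕜 A] (G : Type v) [Group G] [TopologicalSpace G] where
  act : G →* (A →L[𝕜] A)
  act_mul : ∀ r a b, act r (a * b) = act r a * act r b
  continuous_act : ∀ a, Continuous fun r => act r a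

/-- `A` has a bounded approximate left identity (a bounded net `uᵢ` with `uᵢ a → a` for all `a`),
phrased through the filter on `A` of tails of the net. -/
def IsBoundedApproxLeftIdentity {A : Type*} [NonUnitalNormedRing A] (l : Filter A) : Prop :=
  l.NeBot ∧ (∃ M : ℝ, ∀ᶠ e in l, ‖e‖ ≤ M) ∧ ∀ a : A, Tendsto (fun e => e * a) l (𝓝 a)

def HasBoundedApproxLeftIdentity (A : Type*) [NonUnitalNormedRing A] : Prop :=
  ∃ l : Filter A, IsBoundedApproxLeftIdentity l

/-- A representation `T` of an algebra on a Banach space `X` is non-degenerate if the span of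
`T(A) X` is dense in `X`. -/
def IsNondegenerate {𝕜 : Type*} [RCLike 𝕜] {A : Type*} [NonUnitalNormedRing A] [NormedSpace 𝕜 A]
    {X : Type*} [NormedAddCommGroup X] [NormedSpace 𝕜 X] (T : A →ₙₐ[𝕜] (X →L[𝕜] X)) : Prop :=
  Dense (Submodule.span 𝕜 {y : X | ∃ a x, T a x = y} : Set X)

theorem hasCompactSupport_left {G A E : Type*} [TopologicalSpace G] [R1Space G]
    [TopologicalSpace A] [Zero A] [Zero E] (f : C_c(G, A)) (F : G → E)
    (h : ∀ r, f r = 0 → F r = 0) : HasCompactSupport F :=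
  HasCompactSupport.intro (K := tsupport f) f.hasCompactSupport (fun r hr =>
    h r (image_eq_zero_of_notMem_tsupport hr))

section Convolution

variable {𝕜 : Type*} [RCLike 𝕜]
  {A : Type u} [NonUnitalNormedRing A] [NormedSpace 𝕜 A] [IsScalarTower 𝕜 A A]
  [SMulCommClass 𝕜 A A] [CompleteSpace A]
  {G : Type v} [Group G] [TopologicalSpace G] [IsTopologicalGroup G] [LocallyCompactSpace G]
  (D : DynamicalSystem 𝕜 A G)

theorem DynamicalSystem.continuous_act_comp {X : Type*} [TopologicalSpace X]
    {r : X → G} {a : X → A}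
    (hr : Continuous r) (ha : Continuous a) : Continuous fun x => D.act (r x) (a x) :=
  (continuous_uncurry_rep D.act D.continuous_act).comp (hr.prodMk ha)

theorem twisted_zero (f g : C_c(G, A)) {s r : G}
    (h : r ∉ tsupport f ∨ r⁻¹ * s ∉ tsupport g) :
    f r * D.act r (g (r⁻¹ * s)) = 0 := by
  rcases h with h | h
  · rw [image_eq_zero_of_notMem_tsupport h, zero_mul]
  · rw [image_eq_zero_of_notMem_tsupport h, map_zero, mul_zero]

variable [MeasurableSpace G] [BorelSpace G] (μ : Measure G) [μ.IsHaarMeasure]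

theorem continuous_twisted (f g : C_c(G, A)) :
    Continuous (Function.uncurry fun s r : G => f r * D.act r (g (r⁻¹ * s))) := by
  have hf := f.continuous
  have hg := g.continuous
  exact (hf.comp continuous_snd).mul (D.continuous_act_comp continuous_snd (by fun_prop))

theorem isCompact_tsupport_mul (f g : C_c(G, A)) :
    IsCompact ((fun p : G × G => p.1 * p.2) '' (tsupport f ×ˢ tsupport g)) :=
  (IsCompact.prod f.hasCompactSupport g.hasCompactSupport).image continuous_mul

theorem twisted_zero' (f g : C_c(G, A)) {s r : G}
    (h : s ∉ (fun p : G × G => p.1 * p.2) '' (tsupport f ×ˢ tsupport g)) :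
    f r * D.act r (g (r⁻¹ * s)) = 0 := by
  by_contra hne
  have h1 : ¬ (r ∉ tsupport f ∨ r⁻¹ * s ∉ tsupport g) := fun h => hne (twisted_zero D f g h)
  push Not at h1
  exact h ⟨(r, r⁻¹ * s), ⟨h1.1, h1.2⟩, by simp⟩

/-- Twisted convolution `[f * g](s) = ∫ f(r) α_r(g(r⁻¹ s)) dr` on `C_c(G, A)`. -/
def conv (f g : C_c(G, A)) : C_c(G, A) where
  toFun s := vint 𝕜 μ (fun r => f r * D.act r (g (r⁻¹ * s)))
  continuous_toFun := continuous_vint (f := fun s r => f r * D.act r (g (r⁻¹ * s)))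
    f.hasCompactSupport (continuous_twisted D f g)
    (fun _ _ hr => twisted_zero D f g (Or.inl hr))
  hasCompactSupport' := HasCompactSupport.intro (isCompact_tsupport_mul f g) (fun _ hs =>
    (vint_congr (fun _ => twisted_zero' D f g hs)).trans vint_zero)

theorem conv_apply (f g : C_c(G, A)) (s : G) :
    conv D μ f g s = vint 𝕜 μ (fun r => f r * D.act r (g (r⁻¹ * s))) := rfl

theorem vint_conv {E F : Type*} [NormedAddCommGroup E] [NormedSpace 𝕜 E]
    [NormedAddCommGroup F] [NormedSpace 𝕜 F] [CompleteSpace F] (f g : C_c(G, A))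
    (L : A →L[𝕜] E →L[𝕜] F) (v : G → E) (hv : Continuous v) :
    vint 𝕜 μ (fun s => L (conv D μ f g s) (v s)) =
      vint 𝕜 μ (fun r => vint 𝕜 μ (fun s => L (f r * D.act r (g s)) (v (r * s)))) := by
  have hcont := continuous_twisted D f g
  have h1 : ∀ s, L (conv D μ f g s) (v s) =
      vint 𝕜 μ (fun r => L (f r * D.act r (g (r⁻¹ * s))) (v s)) := fun s => by
    have := clm_vint (μ := μ) (L.flip (v s)) (f := fun r => f r * D.act r (g (r⁻¹ * s)))
      (hcont.comp (Continuous.prodMk_right s))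
      (hasCompactSupport_left f _ (fun r hr => by rw [hr, zero_mul]))
    exact this
  rw [vint_congr h1, vint_swap]
  · refine vint_congr (fun r => ?_)
    rw [← vint_mul_left (fun s => L (f r * D.act r (g (r⁻¹ * s))) (v s)) r]
    simp only [inv_mul_cancel_left]
  · exact (L.continuous.comp hcont).clm_apply (hv.comp continuous_fst)
  · refine HasCompactSupport.intro (IsCompact.prod (isCompact_tsupport_mul f g) f.hasCompactSupport)
      (fun p hp => ?_)
    have : f p.2 * D.act p.2 (g (p.2⁻¹ * p.1)) = 0 := by
      rw [Set.mem_prod, not_and_or] at hp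
      exact hp.elim (twisted_zero' D f g) (fun h => twisted_zero D f g (Or.inl h))
    simp only [Function.uncurry_def]
    rw [this, map_zero, zero_apply]

theorem conv_assoc (f g h : C_c(G, A)) :
    conv D μ (conv D μ f g) h = conv D μ f (conv D μ g h) := by
  ext t
  rw [conv_apply, conv_apply]
  have hh := h.continuous
  have hg := g.continuous
  refine (vint_conv D μ f g (ContinuousLinearMap.mul 𝕜 A) (fun s => D.act s (h (s⁻¹ * t)))
    (D.continuous_act_comp continuous_id (by fun_prop))).trans (vint_congr fun r => ?_)
  have h2 := clm_vint (μ := μ) ((ContinuousLinearMap.mul 𝕜 A (f r)).comp (D.act r))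
    (f := fun s => g s * D.act s (h (s⁻¹ * (r⁻¹ * t))))
    (hg.mul (D.continuous_act_comp continuous_id (by fun_prop)))
    (hasCompactSupport_left g _ (fun r hr => by rw [hr, zero_mul]))
  rw [conv_apply]
  refine Eq.trans ?_ h2.symm
  refine vint_congr fun s => ?_
  simp [D.act_mul, mul_assoc]

theorem continuous_twisted_right (f g : C_c(G, A)) (s : G) :
    Continuous (fun r : G => f r * D.act r (g (r⁻¹ * s))) :=
  (continuous_twisted D f g).comp (Continuous.prodMk_right s)

theorem hasCompactSupport_twisted (f g : C_c(G, A)) (s : G) :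
    HasCompactSupport (fun r : G => f r * D.act r (g (r⁻¹ * s))) :=
  hasCompactSupport_left f _ (fun r hr => by rw [hr, zero_mul])

theorem conv_add (f g h : C_c(G, A)) :
    conv D μ f (g + h) = conv D μ f g + conv D μ f h := by
  ext s
  simp only [conv_apply, CompactlySupportedContinuousMap.add_apply, map_add, mul_add]
  exact vint_add (continuous_twisted_right D f g s) (hasCompactSupport_twisted D f g s)
    (continuous_twisted_right D f h s) (hasCompactSupport_twisted D f h s)

theorem add_conv (f g h : C_c(G, A)) :
    conv D μ (f + g) h = conv D μ f h + conv D μ g h := by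
  ext s
  simp only [conv_apply, CompactlySupportedContinuousMap.add_apply, add_mul]
  exact vint_add (continuous_twisted_right D f h s) (hasCompactSupport_twisted D f h s)
    (continuous_twisted_right D g h s) (hasCompactSupport_twisted D g h s)

theorem smul_conv (c : 𝕜) (f g : C_c(G, A)) :
    conv D μ (c • f) g = c • conv D μ f g := by
  ext s
  simp only [conv_apply, CompactlySupportedContinuousMap.smul_apply, smul_mul_assoc]
  exact (clm_vint (c • ContinuousLinearMap.id 𝕜 A) (continuous_twisted_right D f g s)
    (hasCompactSupport_twisted D f g s)).symm

theorem conv_smul (c : 𝕜) (f g : C_c(G, A)) :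
    conv D μ f (c • g) = c • conv D μ f g := by
  ext s
  simp only [conv_apply, CompactlySupportedContinuousMap.smul_apply, map_smul, mul_smul_comm]
  exact (clm_vint (c • ContinuousLinearMap.id 𝕜 A) (continuous_twisted_right D f g s)
    (hasCompactSupport_twisted D f g s)).symm

/-! ### The actions of `A` and `G` on `C_c(G, A)` -/

/-- `(i_A(a) f)(s) = a f(s)`. -/
def actA (a : A) : C_c(G, A) →ₗ[𝕜] C_c(G, A) where
  toFun f :=
    { toFun := fun s => a * f s
      continuous_toFun := continuous_const.mul f.continuous
      hasCompactSupport' := hasCompactSupport_left f _ (fun r hr => by rw [hr, mul_zero]) }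
  map_add' f g := by ext s; exact mul_add a (f s) (g s)
  map_smul' c f := by ext s; exact mul_smul_comm c a (f s)

/-- `(i_G(r) f)(s) = α_r(f(r⁻¹ s))`. -/
def actG (r : G) : C_c(G, A) →ₗ[𝕜] C_c(G, A) where
  toFun f :=
    { toFun := fun s => D.act r (f (r⁻¹ * s))
      continuous_toFun := (D.act r).continuous.comp (f.continuous.comp (by fun_prop))
      hasCompactSupport' :=
        (f.hasCompactSupport.comp_homeomorph (Homeomorph.mulLeft r⁻¹)).comp_left (map_zero _) }
  map_add' f g := by ext s; exact map_add (D.act r) _ _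
  map_smul' c f := by ext s; exact map_smul (D.act r) c _

theorem actA_apply (a : A) (f : C_c(G, A)) (s : G) : actA (𝕜 := 𝕜) a f s = a * f s := rfl

theorem actG_apply (r : G) (f : C_c(G, A)) (s : G) : actG D r f s = D.act r (f (r⁻¹ * s)) := rfl

theorem actA_conv (a : A) (f g : C_c(G, A)) :
    actA (𝕜 := 𝕜) a (conv D μ f g) = conv D μ (actA (𝕜 := 𝕜) a f) g := by
  ext s
  simp only [actA_apply, conv_apply, mul_assoc]
  exact clm_vint (ContinuousLinearMap.mul 𝕜 A a) (continuous_twisted_right D f g s)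
    (hasCompactSupport_twisted D f g s)

theorem actG_conv (r : G) (f g : C_c(G, A)) :
    actG D r (conv D μ f g) = conv D μ (actG D r f) g := by
  ext s
  rw [actG_apply, conv_apply, conv_apply, clm_vint (D.act r) (continuous_twisted_right D f g _)
    (hasCompactSupport_twisted D f g _),
    ← vint_mul_left (fun t => actG D r f t * D.act t (g (t⁻¹ * s))) r]
  refine vint_congr fun t => ?_
  simp [D.act_mul, actG_apply, mul_assoc]

end Convolution

/-! ### Covariant representations and their integrated forms -/

section Covariant

variable {𝕜 : Type*} [RCLike 𝕜]
  {A : Type u} [NonUnitalNormedRing A] [NormedSpace 𝕜 A]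
  {G : Type v} [Group G] [TopologicalSpace G]

/-- A continuous covariant representation `(π, U)` of `(A, G, α)` on `X`: `π` is a bounded
representation of `A`, `U` is a strongly continuous representation of `G`, and
`π(α_r(a)) = U_r π(a) U_r⁻¹`. -/
structure ContCovRep (D : DynamicalSystem 𝕜 A G) (X : Type w) [NormedAddCommGroup X]
    [NormedSpace 𝕜 X] where
  π : A →ₙₐ[𝕜] (X →L[𝕜] X)
  U : G →* (X →L[𝕜] X)
  continuous_π : Continuous π
  continuous_U : ∀ x, Continuous fun r => U r x
  covariant : ∀ r a, π (D.act r a) = U r * π a * U r⁻¹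

namespace ContCovRep

variable {D : DynamicalSystem 𝕜 A G} {X : Type w} [NormedAddCommGroup X]
  [NormedSpace 𝕜 X] (ρ : ContCovRep D X)

/-- `π` as a bounded linear map `A → B(X)`. -/
def πL : A →L[𝕜] X →L[𝕜] X :=
  { toFun := ρ.π, map_add' := map_add ρ.π, map_smul' := map_smul ρ.π, cont := ρ.continuous_π }

@[simp] theorem πL_apply (a : A) : ρ.πL a = ρ.π a := rfl

variable [IsTopologicalGroup G] [LocallyCompactSpace G] [CompleteSpace X]

theorem continuous_integrand (f : C_c(G, A)) (x : X) :
    Continuous fun s => ρ.π (f s) (ρ.U s x) :=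
  (ρ.continuous_π.comp f.continuous).clm_apply (ρ.continuous_U x)

theorem hasCompactSupport_integrand (f : C_c(G, A)) (x : X) :
    HasCompactSupport fun s => ρ.π (f s) (ρ.U s x) :=
  hasCompactSupport_left f _ (fun r hr => by rw [hr, map_zero, zero_apply])

variable [MeasurableSpace G] [BorelSpace G] (μ : Measure G) [μ.IsHaarMeasure]

theorem norm_vint_integrand_le {f : C_c(G, A)} {C M : ℝ} (hC : 0 ≤ C)
    (hπ : ∀ a, ‖ρ.π a‖ ≤ C * ‖a‖) (hU : ∀ r ∈ tsupport f, ‖ρ.U r‖ ≤ M) (x : X) :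
    ‖vint 𝕜 μ (fun s => ρ.π (f s) (ρ.U s x))‖ ≤ C * M * (∫ s, ‖f s‖ ∂μ) * ‖x‖ := by
  have hint : Integrable (fun s => ‖f s‖) μ :=
    (f.continuous.integrable_of_hasCompactSupport f.hasCompactSupport).norm
  refine (norm_vint_le _).trans ?_
  have : C * M * (∫ s, ‖f s‖ ∂μ) * ‖x‖ = ∫ s, C * M * ‖f s‖ * ‖x‖ ∂μ := by
    rw [integral_mul_const, integral_const_mul]
  rw [this]
  refine integral_mono_of_nonneg (Eventually.of_forall fun s => norm_nonneg _)
    ((hint.const_mul _).mul_const _) (Eventually.of_forall fun s => ?_)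
  by_cases hs : s ∈ tsupport f
  · calc ‖ρ.π (f s) (ρ.U s x)‖ ≤ ‖ρ.π (f s)‖ * (‖ρ.U s‖ * ‖x‖) :=
          (ρ.π (f s)).le_opNorm_of_le ((ρ.U s).le_opNorm x)
      _ ≤ (C * ‖f s‖) * (M * ‖x‖) := by
          have h1 := hπ (f s)
          have h2 := hU s hs
          gcongr
      _ = C * M * ‖f s‖ * ‖x‖ := by ring
  · have : f s = 0 := image_eq_zero_of_notMem_tsupport hs
    simp [this]

theorem exists_bound (f : C_c(G, A)) :
    ∃ c : ℝ, ∀ x, ‖vint 𝕜 μ (fun s => ρ.π (f s) (ρ.U s x))‖ ≤ c * ‖x‖ := by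
  obtain ⟨M, -, hM⟩ := exists_bound_on_compact ρ.U ρ.continuous_U
    (K := tsupport f) f.hasCompactSupport
  exact ⟨_, ρ.norm_vint_integrand_le μ (norm_nonneg ρ.πL) (fun a => ρ.πL.le_opNorm a) hM⟩

/-- The integrated form: `(π ⋊ U)(f) x = ∫ π(f(s)) U_s x ds`. -/
def integrated : C_c(G, A) →ₗ[𝕜] (X →L[𝕜] X) where
  toFun f := LinearMap.mkContinuousOfExistsBound
    { toFun := fun x => vint 𝕜 μ (fun s => ρ.π (f s) (ρ.U s x))
      map_add' := fun x y => by
        simp only [map_add]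
        exact vint_add (ρ.continuous_integrand f x) (ρ.hasCompactSupport_integrand f x)
          (ρ.continuous_integrand f y) (ρ.hasCompactSupport_integrand f y)
      map_smul' := fun c x => by
        simp only [map_smul, RingHom.id_apply]
        exact (clm_vint (c • ContinuousLinearMap.id 𝕜 X) (ρ.continuous_integrand f x)
          (ρ.hasCompactSupport_integrand f x)).symm }
    (ρ.exists_bound μ f)
  map_add' f g := by
    ext x
    change vint 𝕜 μ (fun s => ρ.π ((f + g) s) (ρ.U s x)) =
      vint 𝕜 μ (fun s => ρ.π (f s) (ρ.U s x)) + vint 𝕜 μ (fun s => ρ.π (g s) (ρ.U s x))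
    simp only [CompactlySupportedContinuousMap.add_apply, map_add, add_apply]
    exact vint_add (ρ.continuous_integrand f x) (ρ.hasCompactSupport_integrand f x)
      (ρ.continuous_integrand g x) (ρ.hasCompactSupport_integrand g x)
  map_smul' c f := by
    ext x
    change vint 𝕜 μ (fun s => ρ.π ((c • f) s) (ρ.U s x)) =
      c • vint 𝕜 μ (fun s => ρ.π (f s) (ρ.U s x))
    simp only [CompactlySupportedContinuousMap.smul_apply, map_smul,
      smul_apply]
    exact (clm_vint (c • ContinuousLinearMap.id 𝕜 X) (ρ.continuous_integrand f x)
      (ρ.hasCompactSupport_integrand f x)).symm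

theorem integrated_apply (f : C_c(G, A)) (x : X) :
    ρ.integrated μ f x = vint 𝕜 μ (fun s => ρ.π (f s) (ρ.U s x)) := rfl

theorem norm_integrated_le {f : C_c(G, A)} {C M : ℝ} (hC : 0 ≤ C) (hM : 0 ≤ M)
    (hπ : ∀ a, ‖ρ.π a‖ ≤ C * ‖a‖) (hU : ∀ r ∈ tsupport f, ‖ρ.U r‖ ≤ M) :
    ‖ρ.integrated μ f‖ ≤ C * M * (∫ s, ‖f s‖ ∂μ) :=
  ContinuousLinearMap.opNorm_le_bound _
    (mul_nonneg (mul_nonneg hC hM) (integral_nonneg fun _ => norm_nonneg _))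
    (ρ.norm_vint_integrand_le μ hC hπ hU)

variable [IsScalarTower 𝕜 A A] [SMulCommClass 𝕜 A A] [CompleteSpace A]

theorem integrated_conv (f g : C_c(G, A)) :
    ρ.integrated μ (conv D μ f g) = ρ.integrated μ f * ρ.integrated μ g := by
  ext x
  refine (vint_conv D μ f g ρ.πL (fun s => ρ.U s x) (ρ.continuous_U x)).trans ?_
  rw [mul_apply_eq_comp, integrated_apply, integrated_apply]
  refine vint_congr fun r => ?_
  have := clm_vint (μ := μ) (ρ.π (f r) * ρ.U r) (ρ.continuous_integrand g x)
    (ρ.hasCompactSupport_integrand g x)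
  refine Eq.trans (vint_congr fun s => ?_) this.symm
  have h1 : ρ.U r⁻¹ (ρ.U r (ρ.U s x)) = ρ.U s x := by
    rw [← mul_apply_eq_comp, ← map_mul]
    simp
  simp [ρ.covariant, h1]

theorem integrated_actA (a : A) (f : C_c(G, A)) :
    ρ.integrated μ (actA (𝕜 := 𝕜) a f) = ρ.π a * ρ.integrated μ f := by
  ext x
  rw [mul_apply_eq_comp, integrated_apply, integrated_apply,
    clm_vint (ρ.π a) (ρ.continuous_integrand f x) (ρ.hasCompactSupport_integrand f x)]
  refine vint_congr fun s => ?_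
  simp [actA_apply]

theorem integrated_actG (r : G) (f : C_c(G, A)) :
    ρ.integrated μ (actG D r f) = ρ.U r * ρ.integrated μ f := by
  ext x
  rw [mul_apply_eq_comp, integrated_apply, integrated_apply,
    clm_vint (ρ.U r) (ρ.continuous_integrand f x) (ρ.hasCompactSupport_integrand f x),
    ← vint_mul_left (fun s => ρ.π (actG D r f s) (ρ.U s x)) r]
  refine vint_congr fun s => ?_
  have h1 : ρ.U r⁻¹ (ρ.U r (ρ.U s x)) = ρ.U s x := by
    rw [← mul_apply_eq_comp, ← map_mul]
    simp
  simp [actG_apply, ρ.covariant, h1]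

end ContCovRep

end Covariant

/-! ### Uniformly bounded classes, the seminorm and the crossed product -/

section Crossed

variable {𝕜 : Type*} [RCLike 𝕜]
  {A : Type u} [NonUnitalNormedRing A] [NormedSpace 𝕜 A]
  {G : Type v} [Group G] [TopologicalSpace G]

/-- A non-empty uniformly bounded class of continuous covariant representations on Banach spaces:
there are `C ≥ 0` and `ν : G → [0, ∞)`, bounded on compact sets, such that `‖π‖ ≤ C` and
`‖U_r‖ ≤ ν r` for all `(π, U)` in the class and `r` in `G`. -/
structure UniformlyBoundedClass (D : DynamicalSystem 𝕜 A G) where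
  reps : ∀ (X : Type w) [NormedAddCommGroup X] [NormedSpace 𝕜 X] [CompleteSpace X],
    Set (ContCovRep D X)
  nonempty : ∃ (X : Type w) (_ : NormedAddCommGroup X) (_ : NormedSpace 𝕜 X)
    (_ : CompleteSpace X), (reps X).Nonempty
  bounded : ∃ (C : ℝ) (ν : G → ℝ), 0 ≤ C ∧ (∀ r, 0 ≤ ν r) ∧
    (∀ K : Set G, IsCompact K → BddAbove (ν '' K)) ∧
    ∀ (X : Type w) [NormedAddCommGroup X] [NormedSpace 𝕜 X] [CompleteSpace X],
      ∀ ρ ∈ reps X, (∀ a, ‖ρ.π a‖ ≤ C * ‖a‖) ∧ ∀ r, ‖ρ.U r‖ ≤ ν r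

namespace UniformlyBoundedClass

variable {D : DynamicalSystem 𝕜 A G} (R : UniformlyBoundedClass.{u, v, w} D)

/-- All members of the class are non-degenerate. -/
def AllNondegenerate : Prop :=
  ∀ (X : Type w) [NormedAddCommGroup X] [NormedSpace 𝕜 X] [CompleteSpace X],
    ∀ ρ ∈ R.reps X, IsNondegenerate ρ.π

variable [IsTopologicalGroup G] [LocallyCompactSpace G] [MeasurableSpace G] [BorelSpace G]
  (μ : Measure G) [μ.IsHaarMeasure]

/-- The set of norms `‖(π ⋊ U)(f)‖`, `(π, U)` in the class. -/
def normSet (f : C_c(G, A)) : Set ℝ :=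
  {c | ∃ (X : Type w) (_ : NormedAddCommGroup X) (_ : NormedSpace 𝕜 X) (_ : CompleteSpace X),
    ∃ ρ ∈ R.reps X, c = ‖ρ.integrated μ f‖}

theorem normSet_nonempty (f : C_c(G, A)) : (R.normSet μ f).Nonempty := by
  obtain ⟨X, i1, i2, i3, ρ, hρ⟩ := R.nonempty
  exact ⟨_, X, i1, i2, i3, ρ, hρ, rfl⟩

theorem normSet_bddAbove (f : C_c(G, A)) : BddAbove (R.normSet μ f) := by
  obtain ⟨C, ν, hC, hν, hK, h⟩ := R.bounded
  obtain ⟨M, hM⟩ := hK (tsupport f) f.hasCompactSupport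
  refine ⟨C * max M 0 * (∫ s, ‖f s‖ ∂μ), ?_⟩
  rintro c ⟨X, i1, i2, i3, ρ, hρ, rfl⟩
  exact ρ.norm_integrated_le μ hC (le_max_right _ _) (h X ρ hρ).1 (fun r hr =>
    ((h X ρ hρ).2 r).trans ((hM (Set.mem_image_of_mem ν hr)).trans (le_max_left _ _)))

/-- `σ(f) = sup ‖(π ⋊ U)(f)‖` over all `(π, U)` in the class. -/
def sigmaFun (f : C_c(G, A)) : ℝ := sSup (R.normSet μ f)

theorem le_sigmaFun {X : Type w} [NormedAddCommGroup X] [NormedSpace 𝕜 X] [CompleteSpace X]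
    {ρ : ContCovRep D X} (hρ : ρ ∈ R.reps X) (f : C_c(G, A)) :
    ‖ρ.integrated μ f‖ ≤ R.sigmaFun μ f :=
  le_csSup (R.normSet_bddAbove μ f) ⟨X, _, _, _, ρ, hρ, rfl⟩

theorem sigmaFun_le {f : C_c(G, A)} {c : ℝ}
    (h : ∀ (X : Type w) [NormedAddCommGroup X] [NormedSpace 𝕜 X] [CompleteSpace X],
      ∀ ρ ∈ R.reps X, ‖ρ.integrated μ f‖ ≤ c) : R.sigmaFun μ f ≤ c := by
  refine csSup_le (R.normSet_nonempty μ f) ?_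
  rintro c ⟨X, i1, i2, i3, ρ, hρ, rfl⟩
  exact h X ρ hρ

theorem sigmaFun_nonneg (f : C_c(G, A)) : 0 ≤ R.sigmaFun μ f := by
  obtain ⟨X, i1, i2, i3, ρ, hρ⟩ := R.nonempty
  exact (norm_nonneg _).trans (R.le_sigmaFun μ hρ f)

/-- The seminorm `σ` of the class on `C_c(G, A)`. -/
def sigma : Seminorm 𝕜 C_c(G, A) :=
  Seminorm.ofSMulLE (R.sigmaFun μ)
    (le_antisymm (R.sigmaFun_le μ fun X _ _ _ ρ _ => by rw [map_zero, norm_zero])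
      (R.sigmaFun_nonneg μ 0))
    (fun f g => R.sigmaFun_le μ fun X _ _ _ ρ hρ => by
      rw [map_add]
      exact (norm_add_le _ _).trans
        (add_le_add (R.le_sigmaFun μ hρ f) (R.le_sigmaFun μ hρ g)))
    (fun c f => R.sigmaFun_le μ fun X _ _ _ ρ hρ => by
      rw [map_smul]
      exact (norm_smul_le _ _).trans
        (mul_le_mul_of_nonneg_left (R.le_sigmaFun μ hρ f) (norm_nonneg c)))

theorem sigma_apply (f : C_c(G, A)) : R.sigma μ f = R.sigmaFun μ f := rfl

/-- A continuous covariant representation is continuous with respect to the class if its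
integrated form is bounded with respect to the seminorm `σ`. -/
def IsContinuousFor {X : Type*} [NormedAddCommGroup X] [NormedSpace 𝕜 X] [CompleteSpace X]
    (ρ : ContCovRep D X) : Prop :=
  ∃ M : ℝ, ∀ f : C_c(G, A), ‖ρ.integrated μ f‖ ≤ M * R.sigma μ f

variable [IsScalarTower 𝕜 A A] [SMulCommClass 𝕜 A A] [CompleteSpace A]

theorem sigma_conv_le (f g : C_c(G, A)) :
    R.sigma μ (conv D μ f g) ≤ R.sigma μ f * R.sigma μ g :=
  R.sigmaFun_le μ fun X _ _ _ ρ hρ => by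
    rw [ρ.integrated_conv]
    exact (norm_mul_le _ _).trans (mul_le_mul (R.le_sigmaFun μ hρ f) (R.le_sigmaFun μ hρ g)
      (norm_nonneg _) (R.sigmaFun_nonneg μ f))

theorem sigma_actA_le (a : A) : ∃ M : ℝ, ∀ f : C_c(G, A),
    R.sigma μ (actA (𝕜 := 𝕜) a f) ≤ M * R.sigma μ f := by
  obtain ⟨C, ν, hC, hν, hK, h⟩ := R.bounded
  refine ⟨C * ‖a‖, fun f => R.sigmaFun_le μ fun X _ _ _ ρ hρ => ?_⟩
  rw [ρ.integrated_actA]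
  exact (norm_mul_le _ _).trans (mul_le_mul ((h X ρ hρ).1 a) (R.le_sigmaFun μ hρ f)
      (norm_nonneg _) (mul_nonneg hC (norm_nonneg a)))

theorem sigma_actG_le (r : G) : ∃ M : ℝ, ∀ f : C_c(G, A),
    R.sigma μ (actG D r f) ≤ M * R.sigma μ f := by
  obtain ⟨C, ν, hC, hν, hK, h⟩ := R.bounded
  refine ⟨ν r, fun f => R.sigmaFun_le μ fun X _ _ _ ρ hρ => ?_⟩
  rw [ρ.integrated_actG]
  exact (norm_mul_le _ _).trans (mul_le_mul ((h X ρ hρ).2 r) (R.le_sigmaFun μ hρ f)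
      (norm_nonneg _) (hν r))

end UniformlyBoundedClass

end Crossed

/-! ### Completion of a (not necessarily unital) seminormed ring -/

section Completion

open UniformSpace

variable (α : Type*) [NonUnitalSeminormedRing α]

/-- The product on the completion, the continuous extension of the product of `α`. -/
abbrev complMul : Mul (Completion α) :=
  ⟨Function.curry <| (Completion.isDenseInducing_coe.prodMap
    Completion.isDenseInducing_coe).extend
      (fun p : α × α => ((p.1 * p.2 : α) : Completion α))⟩

attribute [local instance] complMul

theorem compl_coe_mul (a b : α) : ((a * b : α) : Completion α) = a * b :=
  ((Completion.isDenseInducing_coe.prodMap Completion.isDenseInducing_coe).extend_eq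
      ((Completion.continuous_coe α).comp (@continuous_mul α _ _ _)) (a, b)).symm

theorem complContinuousMul : ContinuousMul (Completion α) where
  continuous_mul := by
    let m := (AddMonoidHom.mul : α →+ α →+ α).compr₂ Completion.toCompl
    have : Continuous fun p : α × α => m p.1 p.2 :=
      (Completion.continuous_coe α).comp continuous_mul
    have di : IsDenseInducing (Completion.toCompl : α → Completion α) :=
      Completion.isDenseInducing_coe
    exact (di.extend_Z_bilin di this :)

attribute [local instance] complContinuousMul

/-- The completion as a Banach algebra. -/
abbrev complRing : NonUnitalNormedRing (Completion α) where
  __ := (inferInstance : NormedAddCommGroup (Completion α))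
  __ := (inferInstance : Mul (Completion α))
  zero_mul a :=
    Completion.induction_on a (isClosed_eq (by fun_prop) continuous_const)
      fun a => by rw [← Completion.coe_zero, ← compl_coe_mul, zero_mul]
  mul_zero a :=
    Completion.induction_on a (isClosed_eq (by fun_prop) continuous_const)
      fun a => by rw [← Completion.coe_zero, ← compl_coe_mul, mul_zero]
  mul_assoc a b c :=
    Completion.induction_on₃ a b c (isClosed_eq (by fun_prop) (by fun_prop))
      fun a b c => by rw [← compl_coe_mul, ← compl_coe_mul, ← compl_coe_mul, ← compl_coe_mul,
        mul_assoc]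
  left_distrib a b c :=
    Completion.induction_on₃ a b c (isClosed_eq (by fun_prop) (by fun_prop))
      fun a b c => by rw [← Completion.coe_add, ← compl_coe_mul, ← compl_coe_mul,
        ← compl_coe_mul, ← Completion.coe_add, mul_add]
  right_distrib a b c :=
    Completion.induction_on₃ a b c (isClosed_eq (by fun_prop) (by fun_prop))
      fun a b c => by rw [← Completion.coe_add, ← compl_coe_mul, ← compl_coe_mul,
        ← compl_coe_mul, ← Completion.coe_add, add_mul]
  norm_mul_le a b :=
    Completion.induction_on₂ a b (isClosed_le (by fun_prop) (by fun_prop))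
      fun a b => by
        rw [← compl_coe_mul, Completion.norm_coe, Completion.norm_coe, Completion.norm_coe]
        exact norm_mul_le a b

variable (𝕜 : Type*) [RCLike 𝕜] [NormedSpace 𝕜 α]

theorem compl_smul_mul [IsScalarTower 𝕜 α α] (c : 𝕜) (x y : Completion α) :
    (c • x) * y = c • (x * y) :=
  Completion.induction_on₂ x y (isClosed_eq
    (((continuous_const_smul c).comp continuous_fst).mul continuous_snd)
    ((continuous_const_smul c).comp (continuous_fst.mul continuous_snd))) fun a b => by
    rw [← Completion.coe_smul, ← compl_coe_mul, ← compl_coe_mul, ← Completion.coe_smul,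
      smul_mul_assoc]

theorem compl_mul_smul [SMulCommClass 𝕜 α α] (c : 𝕜) (x y : Completion α) :
    x * (c • y) = c • (x * y) :=
  Completion.induction_on₂ x y (isClosed_eq
    (continuous_fst.mul ((continuous_const_smul c).comp continuous_snd))
    ((continuous_const_smul c).comp (continuous_fst.mul continuous_snd))) fun a b => by
    rw [← Completion.coe_smul, ← compl_coe_mul, ← compl_coe_mul, ← Completion.coe_smul,
      mul_smul_comm]

end Completion

section CrossedProduct

variable {𝕜 : Type*} [RCLike 𝕜]
  {A : Type u} [NonUnitalNormedRing A] [NormedSpace 𝕜 A] [IsScalarTower 𝕜 A A]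
  [SMulCommClass 𝕜 A A] [CompleteSpace A]
  {G : Type v} [Group G] [TopologicalSpace G] [IsTopologicalGroup G] [LocallyCompactSpace G]
  [MeasurableSpace G] [BorelSpace G]
  {D : DynamicalSystem 𝕜 A G} (μ : Measure G) [μ.IsHaarMeasure]
  (R : UniformlyBoundedClass.{u, v, w} D)

/-- `C_c(G, A)` with twisted convolution as product and the seminorm `σ` of the class `R`. -/
@[nolint unusedArguments]
def TwistedAlgebra {D : DynamicalSystem 𝕜 A G} (_μ : Measure G)
    (_R : UniformlyBoundedClass.{u, v, w} D) : Type (max u v) := C_c(G, A)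

instance : AddCommGroup (TwistedAlgebra μ R) := inferInstanceAs (AddCommGroup C_c(G, A))

instance : Module 𝕜 (TwistedAlgebra μ R) := inferInstanceAs (Module 𝕜 C_c(G, A))

/-- The seminorm `σ` on the twisted algebra. -/
def TwistedAlgebra.seminorm : AddGroupSeminorm (TwistedAlgebra μ R) where
  toFun f := R.sigma μ f
  map_zero' := map_zero (R.sigma μ)
  add_le' f g := map_add_le_add (R.sigma μ) f g
  neg' f := map_neg_eq_map (R.sigma μ) f

instance : SeminormedAddCommGroup (TwistedAlgebra μ R) :=
  AddGroupSeminorm.toSeminormedAddCommGroup (TwistedAlgebra.seminorm μ R)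

theorem TwistedAlgebra.norm_def (f : TwistedAlgebra μ R) : ‖f‖ = R.sigma μ f := rfl

instance : NonUnitalSeminormedRing (TwistedAlgebra μ R) where
  __ := (inferInstance : SeminormedAddCommGroup (TwistedAlgebra μ R))
  mul f g := conv D μ f g
  left_distrib f g h := conv_add D μ f g h
  right_distrib f g h := add_conv D μ f g h
  zero_mul f := by
    have := smul_conv D μ 0 0 f
    rwa [zero_smul, zero_smul] at this
  mul_zero f := by
    have := conv_smul D μ 0 f 0
    rwa [zero_smul, zero_smul] at this
  mul_assoc f g h := conv_assoc D μ f g h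
  norm_mul_le f g := R.sigma_conv_le μ f g

instance : NormedSpace 𝕜 (TwistedAlgebra μ R) where
  norm_smul_le c f := (map_smul_eq_mul (R.sigma μ) c f).le

instance : IsScalarTower 𝕜 (TwistedAlgebra μ R) (TwistedAlgebra μ R) :=
  ⟨fun c f g => smul_conv D μ c f g⟩

instance : SMulCommClass 𝕜 (TwistedAlgebra μ R) (TwistedAlgebra μ R) :=
  ⟨fun c f g => (conv_smul D μ c f g).symm⟩

/-- The crossed product: the (Hausdorff) completion of `C_c(G, A)` with respect to `σ`, i.e. the
completion of the quotient of `C_c(G, A)` by the kernel of `σ`. -/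
def CrossedProduct : Type (max u v) := UniformSpace.Completion (TwistedAlgebra μ R)

namespace CrossedProduct

/-- The product is the continuous extension of twisted convolution. -/
instance : NonUnitalNormedRing (CrossedProduct μ R) := complRing (TwistedAlgebra μ R)

instance : CompleteSpace (CrossedProduct μ R) :=
  inferInstanceAs (CompleteSpace (UniformSpace.Completion (TwistedAlgebra μ R)))

instance : NormedSpace 𝕜 (CrossedProduct μ R) :=
  inferInstanceAs (NormedSpace 𝕜 (UniformSpace.Completion (TwistedAlgebra μ R)))

instance : IsScalarTower 𝕜 (CrossedProduct μ R) (CrossedProduct μ R) :=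
  ⟨fun c x y => compl_smul_mul (TwistedAlgebra μ R) 𝕜 c x y⟩

instance : SMulCommClass 𝕜 (CrossedProduct μ R) (CrossedProduct μ R) :=
  ⟨fun c x y => (compl_mul_smul (TwistedAlgebra μ R) 𝕜 c x y).symm⟩

/-- The canonical map `q : C_c(G, A) → (A ⋊ G)^R`. -/
def q : C_c(G, A) →ₗ[𝕜] CrossedProduct μ R where
  toFun f := UniformSpace.Completion.coe' (α := TwistedAlgebra μ R) f
  map_add' f g := UniformSpace.Completion.coe_add (α := TwistedAlgebra μ R) f g
  map_smul' c f := UniformSpace.Completion.coe_smul (M := 𝕜) (X := TwistedAlgebra μ R) c f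

theorem q_mul (f g : C_c(G, A)) : q μ R (conv D μ f g) = q μ R f * q μ R g :=
  compl_coe_mul (TwistedAlgebra μ R) f g

theorem norm_q (f : C_c(G, A)) : ‖q μ R f‖ = R.sigma μ f :=
  UniformSpace.Completion.norm_coe (E := TwistedAlgebra μ R) f

theorem denseRange_q : DenseRange (q μ R) :=
  UniformSpace.Completion.denseRange_coe (α := TwistedAlgebra μ R)

theorem induction_on {p : CrossedProduct μ R → Prop} (x : CrossedProduct μ R)
    (hp : IsClosed {x | p x}) (h : ∀ f, p (q μ R f)) : p x :=
  UniformSpace.Completion.induction_on x hp h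

/-- The bounded operator on the crossed product induced by a `σ`-bounded operator on
`C_c(G, A)`. -/
def lift (L : C_c(G, A) →ₗ[𝕜] C_c(G, A))
    (hL : ∃ M : ℝ, ∀ f, R.sigma μ (L f) ≤ M * R.sigma μ f) :
    CrossedProduct μ R →L[𝕜] CrossedProduct μ R :=
  ContinuousLinearMap.completion
    (LinearMap.mkContinuousOfExistsBound
      (E := TwistedAlgebra μ R) (F := TwistedAlgebra μ R) (σ := RingHom.id 𝕜) L hL)

theorem lift_q (L : C_c(G, A) →ₗ[𝕜] C_c(G, A))
    (hL : ∃ M : ℝ, ∀ f, R.sigma μ (L f) ≤ M * R.sigma μ f) (f : C_c(G, A)) :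
    lift μ R L hL (q μ R f) = q μ R (L f) :=
  ContinuousLinearMap.completion_apply_coe
    (LinearMap.mkContinuousOfExistsBound
      (E := TwistedAlgebra μ R) (F := TwistedAlgebra μ R) (σ := RingHom.id 𝕜) L hL) f

end CrossedProduct

end CrossedProduct

/-! ### Left centralizers -/

section LeftCentralizer

variable (𝕜 : Type*) [RCLike 𝕜] (B : Type*) [NonUnitalNormedRing B] [NormedSpace 𝕜 B]
  [IsScalarTower 𝕜 B B] [SMulCommClass 𝕜 B B]

/-- The left centralizer algebra of `B`: the bounded operators `L` on `B` with
`L(ab) = L(a) b`, with the operator norm. -/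
def leftCentralizer : Subalgebra 𝕜 (B →L[𝕜] B) where
  carrier := {L | ∀ a b, L (a * b) = L a * b}
  mul_mem' {L M} hL hM a b := by
    simp only [Set.mem_ofPred_eq] at hL hM
    simp [hM, hL]
  add_mem' {L M} hL hM a b := by
    simp only [Set.mem_ofPred_eq] at hL hM
    simp [hM, hL, add_mul]
  algebraMap_mem' c a b := by
    simp [Algebra.algebraMap_eq_smul_one, smul_mul_assoc]

variable {𝕜 B} in
theorem mem_leftCentralizer {L : B →L[𝕜] B} :
    L ∈ leftCentralizer 𝕜 B ↔ ∀ a b, L (a * b) = L a * b := Iff.rfl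

/-- The left regular representation `λ : B → M_l(B)`, `λ(b) c = b c`. -/
def leftRegular : B →ₙₐ[𝕜] leftCentralizer 𝕜 B where
  toFun b := ⟨ContinuousLinearMap.mul 𝕜 B b, fun a c => (mul_assoc b a c).symm⟩
  map_smul' c b := by ext; simp
  map_zero' := by ext; simp
  map_add' a b := by ext; simp
  map_mul' a b := by ext; simp [mul_assoc]

@[simp] theorem leftRegular_apply (b c : B) : (leftRegular 𝕜 B b : B →L[𝕜] B) c = b * c := rfl

end LeftCentralizer

/-- A topological isomorphism of Banach algebras: a linear homeomorphism that is multiplicative. -/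
structure TopAlgEquiv (𝕜 : Type*) [RCLike 𝕜] (B C : Type*) [NonUnitalNormedRing B]
    [NormedSpace 𝕜 B] [NonUnitalNormedRing C] [NormedSpace 𝕜 C] extends B ≃L[𝕜] C where
  map_mul : ∀ x y, toContinuousLinearEquiv (x * y) =
    toContinuousLinearEquiv x * toContinuousLinearEquiv y

section Congr

variable {𝕜 : Type*} [RCLike 𝕜] {B C : Type*} [NonUnitalNormedRing B] [NormedSpace 𝕜 B]
  [IsScalarTower 𝕜 B B] [SMulCommClass 𝕜 B B] [NonUnitalNormedRing C] [NormedSpace 𝕜 C]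
  [IsScalarTower 𝕜 C C] [SMulCommClass 𝕜 C C]

theorem conj_mem (ψ : TopAlgEquiv 𝕜 B C) {L : B →L[𝕜] B} (hL : L ∈ leftCentralizer 𝕜 B) :
    ψ.toContinuousLinearEquiv.conjContinuousAlgEquiv L ∈ leftCentralizer 𝕜 C := by
  intro x y
  have h : ψ.toContinuousLinearEquiv.symm (x * y) =
      ψ.toContinuousLinearEquiv.symm x * ψ.toContinuousLinearEquiv.symm y := by
    rw [ContinuousLinearEquiv.symm_apply_eq, ψ.map_mul]
    simp
  rw [mem_leftCentralizer] at hL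
  simp [h, hL, ψ.map_mul]

/-- The inverse of a topological isomorphism. -/
def TopAlgEquiv.symm (ψ : TopAlgEquiv 𝕜 B C) : TopAlgEquiv 𝕜 C B where
  toContinuousLinearEquiv := ψ.toContinuousLinearEquiv.symm
  map_mul x y := by
    rw [ContinuousLinearEquiv.symm_apply_eq, ψ.map_mul]
    simp

/-- The topological isomorphism `ψ_l : M_l(B) → M_l(C)`, `ψ_l(L) = ψ L ψ⁻¹`. -/
def TopAlgEquiv.leftCentralizerCongr (ψ : TopAlgEquiv 𝕜 B C) :
    leftCentralizer 𝕜 B ≃A[𝕜] leftCentralizer 𝕜 C where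
  toFun L := ⟨ψ.toContinuousLinearEquiv.conjContinuousAlgEquiv L, conj_mem ψ L.2⟩
  invFun L := ⟨ψ.symm.toContinuousLinearEquiv.conjContinuousAlgEquiv L, conj_mem ψ.symm L.2⟩
  left_inv L := by
    ext x
    simp [TopAlgEquiv.symm]
  right_inv L := by
    ext x
    simp [TopAlgEquiv.symm]
  map_mul' L M := by
    ext x
    simp
  map_add' L M := by
    ext x
    simp
  commutes' c := by
    ext x
    simp
  continuous_toFun := by
    refine Continuous.subtype_mk ?_ _
    exact ψ.toContinuousLinearEquiv.conjContinuousAlgEquiv.continuous.comp continuous_subtype_val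
  continuous_invFun := by
    refine Continuous.subtype_mk ?_ _
    exact ψ.symm.toContinuousLinearEquiv.conjContinuousAlgEquiv.continuous.comp
      continuous_subtype_val

theorem TopAlgEquiv.leftCentralizerCongr_apply (ψ : TopAlgEquiv 𝕜 B C)
    (L : leftCentralizer 𝕜 B) (c : C) : (ψ.leftCentralizerCongr L : C →L[𝕜] C) c =
      ψ.toContinuousLinearEquiv ((L : B →L[𝕜] B) (ψ.toContinuousLinearEquiv.symm c)) := rfl

end Congr

/-! ### The canonical pair `(i_A, i_G)` -/

section CanonicalPair

variable {𝕜 : Type*} [RCLike 𝕜]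
  {A : Type u} [NonUnitalNormedRing A] [NormedSpace 𝕜 A] [IsScalarTower 𝕜 A A]
  [SMulCommClass 𝕜 A A] [CompleteSpace A]
  {G : Type v} [Group G] [TopologicalSpace G] [IsTopologicalGroup G] [LocallyCompactSpace G]
  [MeasurableSpace G] [BorelSpace G]
  {D : DynamicalSystem 𝕜 A G} (μ : Measure G) [μ.IsHaarMeasure]
  (R : UniformlyBoundedClass.{u, v, w} D)

namespace CrossedProduct

theorem lift_mem (L : C_c(G, A) →ₗ[𝕜] C_c(G, A))
    (hL : ∃ M : ℝ, ∀ f, R.sigma μ (L f) ≤ M * R.sigma μ f)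
    (h : ∀ f g, L (conv D μ f g) = conv D μ (L f) g) :
    lift μ R L hL ∈ leftCentralizer 𝕜 (CrossedProduct μ R) := by
  intro x y
  refine induction_on μ R (p := fun x => lift μ R L hL (x * y) = lift μ R L hL x * y) x
    (isClosed_eq ((lift μ R L hL).continuous.comp (continuous_id.mul continuous_const))
      ((lift μ R L hL).continuous.mul continuous_const)) fun f => ?_
  refine induction_on μ R
    (p := fun y => lift μ R L hL (q μ R f * y) = lift μ R L hL (q μ R f) * y) y
    (isClosed_eq ((lift μ R L hL).continuous.comp (continuous_const.mul continuous_id))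
      (continuous_const.mul continuous_id)) fun g => ?_
  rw [← q_mul, lift_q, lift_q, h, q_mul]

/-- `i_A(a)` as a left centralizer of the crossed product: `i_A(a) q(f) = q(a f)`. -/
def iA (a : A) : leftCentralizer 𝕜 (CrossedProduct μ R) :=
  ⟨lift μ R (actA a) (R.sigma_actA_le μ a), lift_mem μ R _ _ (actA_conv D μ a)⟩

/-- `i_G(r)` as a left centralizer of the crossed product: `i_G(r) q(f) = q(α_r(f(r⁻¹ ·)))`. -/
def iG (r : G) : leftCentralizer 𝕜 (CrossedProduct μ R) :=
  ⟨lift μ R (actG D r) (R.sigma_actG_le μ r), lift_mem μ R _ _ (actG_conv D μ r)⟩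

theorem iA_q (a : A) (f : C_c(G, A)) :
    (iA μ R a : CrossedProduct μ R →L[𝕜] CrossedProduct μ R) (q μ R f) =
      q μ R (actA (𝕜 := 𝕜) a f) := lift_q μ R _ _ f

theorem iG_q (r : G) (f : C_c(G, A)) :
    (iG μ R r : CrossedProduct μ R →L[𝕜] CrossedProduct μ R) (q μ R f) =
      q μ R (actG D r f) := lift_q μ R _ _ f

end CrossedProduct

end CanonicalPair

/-! ### Extending representations to the left centralizer algebra -/

section InducedRep

variable {𝕜 : Type*} [RCLike 𝕜] {B : Type*} [NonUnitalNormedRing B] [NormedSpace 𝕜 B]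
  [IsScalarTower 𝕜 B B] [SMulCommClass 𝕜 B B]
  {X : Type*} [NormedAddCommGroup X] [NormedSpace 𝕜 X]

theorem IsNondegenerate.ext {T : B →ₙₐ[𝕜] (X →L[𝕜] X)} (hT : IsNondegenerate T)
    {P Q : X →L[𝕜] X} (h : ∀ b x, P (T b x) = Q (T b x)) : P = Q := by
  refine ContinuousLinearMap.ext_on hT ?_
  rintro _ ⟨b, x, rfl⟩
  exact h b x

theorem exists_norm_le {T : B →ₙₐ[𝕜] (X →L[𝕜] X)} (hc : Continuous T) :
    ∃ K, 0 ≤ K ∧ ∀ b, ‖T b‖ ≤ K * ‖b‖ := by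
  let T' : B →L[𝕜] (X →L[𝕜] X) :=
    { toFun := T, map_add' := map_add T, map_smul' := map_smul T, cont := hc }
  exact ⟨‖T'‖, norm_nonneg T', fun b => T'.le_opNorm b⟩

theorem tendsto_on_range {l : Filter B} (hl : IsBoundedApproxLeftIdentity l)
    {T : B →ₙₐ[𝕜] (X →L[𝕜] X)} (hc : Continuous T) {L : B →L[𝕜] B}
    (hL : L ∈ leftCentralizer 𝕜 B) (b : B) (x : X) :
    Tendsto (fun e => T (L e) (T b x)) l (𝓝 (T (L b) x)) := by
  have h1 : ∀ e, T (L e) (T b x) = T (L (e * b)) x := fun e => by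
    rw [hL e b, map_mul, mul_apply_eq_comp]
  simp only [h1]
  have h2 : Continuous fun e : B => T (L e) x :=
    (hc.comp L.continuous).clm_apply continuous_const
  exact (h2.tendsto b).comp (hl.2.2 b)

/-- Existence of the strong limits defining the extension to the left centralizer algebra. -/
theorem exists_limit [CompleteSpace X] {l : Filter B} (hl : IsBoundedApproxLeftIdentity l)
    {T : B →ₙₐ[𝕜] (X →L[𝕜] X)} (hc : Continuous T) (hT : IsNondegenerate T) :
    ∃ K, 0 ≤ K ∧ ∀ L ∈ leftCentralizer 𝕜 B, ∃ S : X →L[𝕜] X, ‖S‖ ≤ K * ‖L‖ ∧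
      ∀ x, Tendsto (fun e => T (L e) x) l (𝓝 (S x)) := by
  obtain ⟨K, hK0, hK⟩ := exists_norm_le hc
  obtain ⟨M, hM⟩ := hl.2.1
  have := hl.1
  refine ⟨K * max M 0, mul_nonneg hK0 (le_max_right _ _), fun L hL => ?_⟩
  set N := K * max M 0 * ‖L‖ with hN
  have hN0 : 0 ≤ N := by positivity
  have hb : ∀ᶠ e in l, ‖T (L e)‖ ≤ N := by
    filter_upwards [hM] with e he
    calc ‖T (L e)‖ ≤ K * ‖L e‖ := hK _
      _ ≤ K * (‖L‖ * max M 0) := by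
          have h1 := L.le_opNorm_of_le (he.trans (le_max_left M 0))
          gcongr
      _ = N := by rw [hN]; ring
  have hspan : ∀ x ∈ Submodule.span 𝕜 {y : X | ∃ a x, T a x = y},
      ∃ z, Tendsto (fun e => T (L e) x) l (𝓝 z) := by
    intro x hx
    induction hx using Submodule.span_induction with
    | mem x hx =>
      obtain ⟨b, x, rfl⟩ := hx
      exact ⟨_, tendsto_on_range hl hc hL b x⟩
    | zero => exact ⟨0, by simp⟩
    | add x y _ _ hx hy =>
      obtain ⟨z, hz⟩ := hx
      obtain ⟨w, hw⟩ := hy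
      exact ⟨z + w, by simpa using hz.add hw⟩
    | smul c x _ hx =>
      obtain ⟨z, hz⟩ := hx
      exact ⟨c • z, by simpa using hz.const_smul c⟩
  have hlim : ∀ x, ∃ z, Tendsto (fun e => T (L e) x) l (𝓝 z) := by
    intro x
    refine cauchy_map_iff_exists_tendsto.1 ?_
    rw [Metric.cauchy_iff]
    refine ⟨inferInstance, fun ε hε => ?_⟩
    obtain ⟨y, hy, hxy⟩ := Metric.dense_iff.1 hT x (ε / (4 * (N + 1))) (by positivity)
    obtain ⟨z, hz⟩ := hspan y hxy
    refine ⟨Metric.ball z (ε / 2), ?_, fun p hp q hq => ?_⟩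
    · rw [Filter.mem_map]
      filter_upwards [hb, Metric.tendsto_nhds.1 hz (ε / 4) (by positivity)] with e he1 he2
      have h3 : ‖T (L e) x - T (L e) y‖ ≤ ε / 4 := by
        rw [← map_sub]
        have h4 : ‖x - y‖ ≤ ε / (4 * (N + 1)) := by
          rw [Metric.mem_ball, dist_comm, dist_eq_norm] at hy
          exact hy.le
        calc ‖T (L e) (x - y)‖ ≤ N * (ε / (4 * (N + 1))) := (T (L e)).le_of_opNorm_le_of_le he1 h4
          _ ≤ (N + 1) * (ε / (4 * (N + 1))) := by gcongr; linarith
          _ = ε / 4 := by field_simp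
      rw [Set.mem_preimage, Metric.mem_ball]
      have h5 := dist_triangle (T (L e) x) (T (L e) y) z
      rw [dist_eq_norm (T (L e) x) (T (L e) y)] at h5
      linarith
    · rw [Metric.mem_ball] at hp hq
      have := dist_triangle_right p q z
      linarith
  choose S hS using hlim
  have hSb : ∀ x, ‖S x‖ ≤ N * ‖x‖ := fun x =>
    le_of_tendsto (hS x).norm (hb.mono fun e he => (T (L e)).le_of_opNorm_le he x)
  let S' : X →ₗ[𝕜] X :=
    { toFun := S
      map_add' := fun x y => tendsto_nhds_unique (hS (x + y))
        (by simpa using (hS x).add (hS y))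
      map_smul' := fun c x => tendsto_nhds_unique (hS (c • x))
        (by simpa using (hS x).const_smul c) }
  exact ⟨S'.mkContinuous N hSb, S'.mkContinuous_norm_le hN0 hSb, hS⟩

/-- A non-degenerate bounded representation `T` of a Banach algebra `B` with a bounded approximate
left identity induces a bounded representation `T̄` of `M_l(B)` with `T̄ ∘ λ = T`, given by
`T̄(L) = SOT-lim T(L eᵢ)` for every bounded approximate left identity `(eᵢ)`. -/
theorem exists_inducedRep [CompleteSpace X] (hB : HasBoundedApproxLeftIdentity B)
    (T : B →ₙₐ[𝕜] (X →L[𝕜] X)) (hc : Continuous T) (hT : IsNondegenerate T) :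
    ∃ S : leftCentralizer 𝕜 B →ₐ[𝕜] (X →L[𝕜] X), Continuous S ∧
      (∀ b, S (leftRegular 𝕜 B b) = T b) ∧
      ∀ (l : Filter B), IsBoundedApproxLeftIdentity l → ∀ (L : leftCentralizer 𝕜 B) (x : X),
        Tendsto (fun e => T ((L : B →L[𝕜] B) e) x) l (𝓝 (S L x)) := by
  obtain ⟨l₀, hl₀⟩ := hB
  obtain ⟨K, hK0, hK⟩ := exists_limit hl₀ hc hT
  choose S hSn hS using hK
  have := hl₀.1
  have key : ∀ L hL b x, S L hL (T b x) = T (L b) x := fun L hL b x =>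
    tendsto_nhds_unique (hS L hL _) (tendsto_on_range hl₀ hc hL b x)
  let S' : leftCentralizer 𝕜 B →ₐ[𝕜] (X →L[𝕜] X) := AlgHom.ofLinearMap
    { toFun := fun L => S L L.2
      map_add' := fun L M => hT.ext fun b x => by simp [key]
      map_smul' := fun c L => hT.ext fun b x => by simp [key] }
    (hT.ext fun b x => by simp [key])
    (fun L M => hT.ext fun b x => by simp [key])
  refine ⟨S', ?_, ?_, ?_⟩
  · refine AddMonoidHomClass.continuous_of_bound S' K fun L => hSn L L.2
  · refine fun b => hT.ext fun b' x => (key _ _ b' x).trans ?_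
    rw [leftRegular_apply, map_mul, mul_apply_eq_comp]
  · intro l hl L x
    obtain ⟨K', _, hK'⟩ := exists_limit hl hc hT
    obtain ⟨P, _, hP⟩ := hK' L L.2
    have := hl.1
    have hPS : P = S' L := hT.ext fun b x =>
      (tendsto_nhds_unique (hP _) (tendsto_on_range hl hc L.2 b x)).trans (key L L.2 b x).symm
    rw [← hPS]
    exact hP x

/-- The representation `T̄` of `M_l(B)` induced by the non-degenerate bounded representation `T`
of `B`. -/
def inducedRep [CompleteSpace X] (hB : HasBoundedApproxLeftIdentity B)
    (T : B →ₙₐ[𝕜] (X →L[𝕜] X)) (hc : Continuous T) (hT : IsNondegenerate T) :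
    leftCentralizer 𝕜 B →ₐ[𝕜] (X →L[𝕜] X) :=
  Classical.choose (exists_inducedRep hB T hc hT)

variable [CompleteSpace X] (hB : HasBoundedApproxLeftIdentity B)
    (T : B →ₙₐ[𝕜] (X →L[𝕜] X)) (hc : Continuous T) (hT : IsNondegenerate T)

theorem continuous_inducedRep : Continuous (inducedRep hB T hc hT) :=
  (Classical.choose_spec (exists_inducedRep hB T hc hT)).1

theorem inducedRep_leftRegular (b : B) : inducedRep hB T hc hT (leftRegular 𝕜 B b) = T b :=
  (Classical.choose_spec (exists_inducedRep hB T hc hT)).2.1 b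

theorem tendsto_inducedRep {l : Filter B} (hl : IsBoundedApproxLeftIdentity l)
    (L : leftCentralizer 𝕜 B) (x : X) :
    Tendsto (fun e => T ((L : B →L[𝕜] B) e) x) l (𝓝 (inducedRep hB T hc hT L x)) :=
  (Classical.choose_spec (exists_inducedRep hB T hc hT)).2.2 l hl L x

end InducedRep

end BanachCrossedProduct
end

open BanachCrossedProduct

namespace BanachCrossedProduct

/-! ### `ℓ¹`-direct sums of covariant representations -/

section Diagonal

variable {𝕜 : Type*} [RCLike 𝕜] {ι : Type*} {E : ι → Type*} [∀ i, NormedAddCommGroup (E i)]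
  [∀ i, NormedSpace 𝕜 (E i)]

/-! Conditions 2 and 3, with `λ` an embedding, give a multiplicative map `F = λ⁻¹ ∘ (k_A ⋊ k_G)`
from `C_c(G, A)` onto a dense subalgebra of `B`. The crossed product is the completion of `C_c(G,
A)` for `σ`, so existence of `ψ` reduces to the equivalence of `‖F f‖` and `σ(f)`; `ψ` is then the
extension of `F` (`exists_topAlgEquiv`).

The bound `‖F f‖ ≤ const · σ(f)` is the `R`-continuity of `(k_A, k_G)` together with the fact that
`λ` is bounded below. The reverse bound is where the generating property enters. For each `f` pick a
member of `R` that attains at least half of `σ(f)`; the `ℓ¹`-direct sum `τ` of these is again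
non-degenerate and `R`-continuous, and `σ(f) ≤ 2 ‖τ(f)‖` for all `f`, where `τ(f)` denotes the
integrated form (`UniformlyBoundedClass.exists_norming`). The hypothesis applied to `τ` yields a
bounded `T` on `B` whose extension to `M_l(B)` carries `(k_A, k_G)` to `τ`. Integrating gives `T (F
f) = τ(f)` (`rep_eq_integrated`), hence `σ(f) ≤ 2 K ‖F f‖` with `K` a bound for `T`.

The intertwining relations hold on the dense set of elements `F f`, because `k_A(a)` and `k_G(r)`
act on integrated forms as `a` and `r` act on `C_c(G, A)`. For uniqueness, the intertwining
relations force `λ(ψ'(q f)) = (k_A ⋊ k_G)(f) = λ(F f)` for every admissible `ψ'`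
(`mul_eq_integrated`), so `ψ'` is determined on the dense range of `q`. -/

theorem lp_one_hasSum_norm (x : lp E 1) : HasSum (fun i => ‖x i‖) ‖x‖ := by
  simpa using lp.hasSum_norm (E := E) (p := 1) (by simp) x

theorem exists_diagonal (S : ∀ i, E i →L[𝕜] E i) {c : ℝ} (hc : 0 ≤ c) (hS : ∀ i, ‖S i‖ ≤ c) :
    ∃ T : lp E 1 →L[𝕜] lp E 1, ‖T‖ ≤ c ∧ ∀ x i, T x i = S i (x i) := by
  have hle : ∀ (x : lp E 1) i, ‖S i (x i)‖ ≤ c * ‖x i‖ := fun x i =>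
    (S i).le_of_opNorm_le (hS i) _
  have hsum : ∀ x : lp E 1, Summable fun i => ‖S i (x i)‖ := fun x =>
    Summable.of_nonneg_of_le (fun _ => norm_nonneg _) (hle x)
      ((lp_one_hasSum_norm x).summable.mul_left c)
  let T : lp E 1 →ₗ[𝕜] lp E 1 :=
    { toFun := fun x => ⟨fun i => S i (x i), memℓp_gen (by simpa using hsum x)⟩
      map_add' := fun x y => by ext i; exact map_add (S i) _ _
      map_smul' := fun a x => by ext i; exact map_smul (S i) a _ }
  have hT : ∀ x, ‖T x‖ ≤ c * ‖x‖ := fun x =>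
    hasSum_le (hle x) (lp_one_hasSum_norm (T x)) ((lp_one_hasSum_norm x).mul_left c)
  exact ⟨T.mkContinuous c hT, T.mkContinuous_norm_le hc hT, fun x i => rfl⟩

/-- The diagonal operator on the `ℓ¹`-direct sum with a uniformly bounded family of entries. -/
noncomputable def diagonal (S : ∀ i, E i →L[𝕜] E i) (hS : ∃ c, 0 ≤ c ∧ ∀ i, ‖S i‖ ≤ c) :
    lp E 1 →L[𝕜] lp E 1 :=
  Classical.choose (exists_diagonal S hS.choose_spec.1 hS.choose_spec.2)

theorem diagonal_apply (S : ∀ i, E i →L[𝕜] E i) (hS : ∃ c, 0 ≤ c ∧ ∀ i, ‖S i‖ ≤ c)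
    (x : lp E 1) (i : ι) : diagonal S hS x i = S i (x i) :=
  (Classical.choose_spec (exists_diagonal S hS.choose_spec.1 hS.choose_spec.2)).2 x i

/-- An operator on the sum is determined by its coordinates, so `T` is the operator built in
`exists_diagonal`. Together with `norm_entry_le` this makes the norm of a diagonal operator the
supremum of the norms of its entries. -/
theorem norm_le_of_diagonal {T : lp E 1 →L[𝕜] lp E 1} {S : ∀ i, E i →L[𝕜] E i}
    (hT : ∀ x i, T x i = S i (x i)) {c : ℝ} (hc : 0 ≤ c) (hS : ∀ i, ‖S i‖ ≤ c) : ‖T‖ ≤ c := by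
  obtain ⟨T', hT', h⟩ := exists_diagonal S hc hS
  have : T = T' := by ext x i; rw [hT, h]
  rwa [this]

/-- Test `T` on vectors supported at `i`: the embedding of `E i` is isometric and the evaluation at
`i` is contractive. -/
theorem norm_entry_le [DecidableEq ι] {T : lp E 1 →L[𝕜] lp E 1} {S : ∀ i, E i →L[𝕜] E i}
    (hT : ∀ x i, T x i = S i (x i)) (i : ι) : ‖S i‖ ≤ ‖T‖ := by
  refine (S i).opNorm_le_bound (norm_nonneg T) fun y => ?_
  have h1 : T (lp.single 1 i y) i = S i y := by rw [hT, lp.single_apply_self]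
  calc ‖S i y‖ = ‖T (lp.single 1 i y) i‖ := by rw [h1]
    _ ≤ ‖T (lp.single 1 i y)‖ := lp.norm_apply_le_norm one_ne_zero _ i
    _ ≤ ‖T‖ * ‖y‖ := by
      refine (T.le_opNorm _).trans_eq ?_
      rw [lp.norm_single zero_lt_one]

theorem diagonal_single [DecidableEq ι] {T : lp E 1 →L[𝕜] lp E 1} {S : ∀ i, E i →L[𝕜] E i}
    (hT : ∀ x i, T x i = S i (x i)) (i : ι) (y : E i) :
    T (lp.single 1 i y) = lp.single 1 i (S i y) := by
  ext j
  rw [hT]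
  rcases eq_or_ne j i with rfl | h
  · simp
  · rw [lp.single_apply_ne _ _ _ h, lp.single_apply_ne _ _ _ h, map_zero]

end Diagonal

/-! ### Covariant representations on `ℓ¹`-sums, and a single representation that norms `σ`. -/

section DirectSum

variable {𝕜 : Type*} [RCLike 𝕜]
  {A : Type u} [NonUnitalNormedRing A] [NormedSpace 𝕜 A]
  {G : Type v} [Group G] [TopologicalSpace G] [LocallyCompactSpace G]
  {D : DynamicalSystem 𝕜 A G} {ι : Type*} {E : ι → Type w} [∀ i, NormedAddCommGroup (E i)]
  [∀ i, NormedSpace 𝕜 (E i)]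

/-- The uniform bounds `C` and `ν r` make the diagonal operators bounded, and the algebraic
identities are checked coordinatewise. Only strong continuity of the group part needs more: it uses
that `ν` is bounded on compact sets and that finitely supported vectors are dense in `ℓ¹`. -/
theorem exists_directSum [∀ i, CompleteSpace (E i)] (ρ : ∀ i, ContCovRep D (E i)) {C : ℝ} {ν : G → ℝ} (hC : 0 ≤ C)
    (hν : ∀ r, 0 ≤ ν r) (hK : ∀ K : Set G, IsCompact K → BddAbove (ν '' K))
    (hπ : ∀ i a, ‖(ρ i).π a‖ ≤ C * ‖a‖) (hU : ∀ i r, ‖(ρ i).U r‖ ≤ ν r) :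
    ∃ τ : ContCovRep D (lp E 1), (∀ a x i, τ.π a x i = (ρ i).π a (x i)) ∧
      ∀ r x i, τ.U r x i = (ρ i).U r (x i) := by
  classical
  have hπ' : ∀ a, ∃ c, 0 ≤ c ∧ ∀ i, ‖(ρ i).π a‖ ≤ c := fun a => ⟨C * ‖a‖, by positivity, (hπ · a)⟩
  have hU' : ∀ r, ∃ c, 0 ≤ c ∧ ∀ i, ‖(ρ i).U r‖ ≤ c := fun r => ⟨ν r, hν r, (hU · r)⟩
  let P : A →ₙₐ[𝕜] (lp E 1 →L[𝕜] lp E 1) :=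
    { toFun := fun a => diagonal (fun i => (ρ i).π a) (hπ' a)
      map_smul' := fun c a => by ext x i; simp [diagonal_apply]
      map_zero' := by ext x i; simp [diagonal_apply]
      map_add' := fun a b => by ext x i; simp [diagonal_apply]
      map_mul' := fun a b => by ext x i; simp [diagonal_apply] }
  let V : G →* (lp E 1 →L[𝕜] lp E 1) :=
    { toFun := fun r => diagonal (fun i => (ρ i).U r) (hU' r)
      map_one' := by ext x i; simp [diagonal_apply]
      map_mul' := fun a b => by ext x i; simp [diagonal_apply] }
  have hP : ∀ a x i, P a x i = (ρ i).π a (x i) := fun a => diagonal_apply _ _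
  have hV : ∀ r x i, V r x i = (ρ i).U r (x i) := fun r => diagonal_apply _ _
  refine ⟨⟨P, V, ?_, fun x => ?_, fun r a => ?_⟩, hP, hV⟩
  · exact AddMonoidHomClass.continuous_of_bound P C fun a =>
      norm_le_of_diagonal (hP a) (by positivity) (hπ · a)
  -- Weierstrass test: near `r₀` the orbit map is a series of continuous functions of `r`, dominated
  -- by the summable family `M * ‖x i‖`, with `M` a bound of `ν` on a compact neighbourhood of `r₀`.
  · have hsum : ∀ r, V r x = ∑' i, lp.single 1 i ((ρ i).U r (x i)) := fun r => by
      have h := lp.hasSum_single (E := E) ENNReal.one_ne_top (V r x)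
      simp only [hV] at h
      exact h.tsum_eq.symm
    rw [continuous_iff_continuousAt]
    intro r₀
    obtain ⟨K, hKc, hKr⟩ := exists_compact_mem_nhds r₀
    obtain ⟨M, hM⟩ := hK K hKc
    simp only [hsum]
    refine ContinuousOn.continuousAt (continuousOn_tsum (u := fun i => M * ‖x i‖) (fun i => ?_)
      ((lp_one_hasSum_norm x).summable.mul_left M) fun i r hr => ?_) hKr
    · exact ((lp.singleContinuousLinearMap 𝕜 E 1 i).continuous.comp
        ((ρ i).continuous_U (x i))).continuousOn
    · rw [lp.norm_single zero_lt_one]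
      exact ((ρ i).U r).le_of_opNorm_le ((hU i r).trans (hM (Set.mem_image_of_mem ν hr))) _
  · ext x i
    simp [hP, hV, (ρ i).covariant]

/-- The closed span of the range contains each summand, since `τ` restricts to `ρ i` there and `ρ i`
is non-degenerate. Every element of an `ℓ¹`-sum is a limit of finite sums of its coordinates. -/
theorem isNondegenerate_directSum {ρ : ∀ i, ContCovRep D (E i)} {τ : ContCovRep D (lp E 1)}
    (hτ : ∀ a x i, τ.π a x i = (ρ i).π a (x i)) (hρ : ∀ i, IsNondegenerate (ρ i).π) :
    IsNondegenerate τ.π := by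
  classical
  set W := (Submodule.span 𝕜 {y : lp E 1 | ∃ a x, τ.π a x = y}).topologicalClosure
  have hsingle : ∀ i (y : E i), lp.single 1 i y ∈ W := fun i y => by
    let F := W.comap (lp.singleContinuousLinearMap 𝕜 E 1 i).toLinearMap
    have hF : IsClosed (F : Set (E i)) := (Submodule.isClosed_topologicalClosure _).preimage
      (lp.singleContinuousLinearMap 𝕜 E 1 i).continuous
    have hle : Submodule.span 𝕜 {y : E i | ∃ a x, (ρ i).π a x = y} ≤ F := by
      rw [Submodule.span_le]
      rintro _ ⟨a, z, rfl⟩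
      refine Submodule.le_topologicalClosure _ (Submodule.subset_span ⟨a, lp.single 1 i z, ?_⟩)
      exact diagonal_single (hτ a) i z
    exact closure_minimal hle hF (hρ i y)
  intro x
  have h := lp.hasSum_single (E := E) ENNReal.one_ne_top x
  exact (Submodule.isClosed_topologicalClosure _).mem_of_tendsto h
    (Eventually.of_forall fun s => W.sum_mem fun i _ => hsingle i _)

variable [IsTopologicalGroup G] [MeasurableSpace G] [BorelSpace G] (μ : Measure G)
  [μ.IsHaarMeasure] [∀ i, CompleteSpace (E i)]

/-- Evaluation at a coordinate is a bounded operator, so it passes under the integral. -/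
theorem integrated_directSum {ρ : ∀ i, ContCovRep D (E i)} {τ : ContCovRep D (lp E 1)}
    (hτ : ∀ a x i, τ.π a x i = (ρ i).π a (x i)) (hτ' : ∀ r x i, τ.U r x i = (ρ i).U r (x i))
    (f : C_c(G, A)) (x : lp E 1) (i : ι) :
    τ.integrated μ f x i = (ρ i).integrated μ f (x i) := by
  refine (clm_vint (lp.evalCLM 𝕜 E 1 i) (τ.continuous_integrand f x)
    (τ.hasCompactSupport_integrand f x)).trans (vint_congr fun s => ?_)
  exact (hτ _ _ _).trans (by rw [hτ'])

/-- A single non-degenerate representation, continuous for `R`, whose integrated form determines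
the seminorm of `R` up to equivalence. -/
theorem UniformlyBoundedClass.exists_norming (R : UniformlyBoundedClass.{u, v, w} D)
    (hR : R.AllNondegenerate) :
    ∃ (X : Type (max u v w)) (_ : NormedAddCommGroup X) (_ : NormedSpace 𝕜 X)
      (_ : CompleteSpace X) (τ : ContCovRep D X), IsNondegenerate τ.π ∧ R.IsContinuousFor μ τ ∧
        ∀ f, R.sigma μ f ≤ 2 * ‖τ.integrated μ f‖ := by
  classical
  -- The supremum defining `σ(f)` need not be attained, hence the factor `2`; when `σ(f) = 0` any
  -- member serves. Choosing one member for each `f` replaces the class by a family indexed by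
  -- `C_c(G, A)`, over which a direct sum can be formed.
  have hex : ∀ f : C_c(G, A), ∃ (X : Type w) (_ : NormedAddCommGroup X) (_ : NormedSpace 𝕜 X)
      (_ : CompleteSpace X), ∃ ρ ∈ R.reps X, R.sigma μ f ≤ 2 * ‖ρ.integrated μ f‖ := fun f => by
    rcases (R.sigmaFun_nonneg μ f).eq_or_lt with h0 | h0
    · obtain ⟨X, i1, i2, i3, ρ, hρ⟩ := R.nonempty
      refine ⟨X, i1, i2, i3, ρ, hρ, ?_⟩
      rw [sigma_apply, ← h0]
      positivity
    · obtain ⟨_, ⟨X, i1, i2, i3, ρ, hρ, rfl⟩, hlt⟩ :=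
        exists_lt_of_lt_csSup (R.normSet_nonempty μ f) (half_lt_self h0)
      refine ⟨X, i1, i2, i3, ρ, hρ, ?_⟩
      rw [sigma_apply]
      change R.sigmaFun μ f / 2 < _ at hlt
      linarith
  choose E i1 i2 i3 ρ hρ hn using hex
  obtain ⟨C, ν, hC, hν, hK, hb⟩ := R.bounded
  obtain ⟨τ, hπ, hU⟩ := exists_directSum ρ hC hν hK (fun i => (hb _ _ (hρ i)).1)
    (fun i => (hb _ _ (hρ i)).2)
  refine ⟨lp E 1, inferInstance, inferInstance, inferInstance, τ,
    isNondegenerate_directSum hπ fun i => hR _ _ (hρ i), ⟨1, fun f => ?_⟩, fun f => ?_⟩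
  · rw [one_mul]
    exact norm_le_of_diagonal (integrated_directSum μ hπ hU f) (R.sigmaFun_nonneg μ f)
      fun i => R.le_sigmaFun μ (hρ i) f
  · exact (hn f).trans (mul_le_mul_of_nonneg_left
      (norm_entry_le (integrated_directSum μ hπ hU f) f) zero_le_two)

end DirectSum

/-! ### Representations induced by the generating pair -/

section Induced

variable {𝕜 : Type*} [RCLike 𝕜] {B : Type*} [NonUnitalNormedRing B] [NormedSpace 𝕜 B]
  [IsScalarTower 𝕜 B B] [SMulCommClass 𝕜 B B]

/-- Along an approximate identity, `T (L e) T b = T (L (e * b))` tends to `T (L b)`. Later arguments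
use the extension `T̄` only through this formula, with no further limits. -/
theorem inducedRep_apply {X : Type*} [NormedAddCommGroup X] [NormedSpace 𝕜 X] [CompleteSpace X]
    (hB : HasBoundedApproxLeftIdentity B) (T : B →ₙₐ[𝕜] (X →L[𝕜] X)) (hc : Continuous T)
    (hT : IsNondegenerate T) (L : leftCentralizer 𝕜 B) (b : B) (x : X) :
    inducedRep hB T hc hT L (T b x) = T ((L : B →L[𝕜] B) b) x := by
  obtain ⟨l, hl⟩ := hB
  have := hl.1
  exact tendsto_nhds_unique (tendsto_inducedRep ⟨l, hl⟩ T hc hT hl L _)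
    (tendsto_on_range hl hc L.2 b x)

/-- An injective linear map with continuous inverse on its range is bounded below. The constant is
`2 / ε`, where `‖λ b‖ < ε` implies `‖b‖ < 1`. -/
theorem exists_norm_le_leftRegular (h : IsEmbedding (leftRegular 𝕜 B)) :
    ∃ c, 0 ≤ c ∧ ∀ b, ‖b‖ ≤ c * ‖leftRegular 𝕜 B b‖ := by
  have h0 := (Metric.nhds_basis_ball.comap (leftRegular 𝕜 B)).mem_iff.1
    ((h.nhds_eq_comap 0) ▸ Metric.ball_mem_nhds (0 : B) one_pos)
  obtain ⟨ε, hε, hsub⟩ := h0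
  refine ⟨2 / ε, by positivity, fun b => ?_⟩
  rcases eq_or_ne (leftRegular 𝕜 B b) 0 with hb | hb
  · have : b = 0 := h.injective (hb.trans (map_zero _).symm)
    rw [this, norm_zero]
    positivity
  have hn : 0 < ‖leftRegular 𝕜 B b‖ := norm_pos_iff.2 hb
  -- This scaling gives `‖λ (t • b)‖ = ε / 2 < ε`, hence `t * ‖b‖ < 1`.
  set t : ℝ := ε / (2 * ‖leftRegular 𝕜 B b‖) with ht
  have ht0 : 0 < t := by positivity
  have hmem : (t : 𝕜) • b ∈ Metric.ball (0 : B) 1 := hsub (by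
    rw [Set.mem_preimage, map_zero, mem_ball_zero_iff, map_smul, norm_smul, RCLike.norm_ofReal,
      abs_of_pos ht0, ht]
    calc _ = ε / 2 := by
          field_simp
          rfl
      _ < ε := half_lt_self hε)
  rw [mem_ball_zero_iff, norm_smul, RCLike.norm_ofReal, abs_of_pos ht0, ht] at hmem
  rw [div_mul_eq_mul_div, le_div_iff₀ hε]
  rw [div_mul_eq_mul_div, div_lt_one (by positivity)] at hmem
  linarith

variable {A : Type u} [NonUnitalNormedRing A] [NormedSpace 𝕜 A]
  {G : Type v} [Group G] [TopologicalSpace G] [IsTopologicalGroup G] [LocallyCompactSpace G]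
  [MeasurableSpace G] [BorelSpace G] (μ : Measure G) [μ.IsHaarMeasure]
  {D : DynamicalSystem 𝕜 A G} [CompleteSpace B]

/-- By non-degeneracy it suffices to compare on vectors `T c x`. There `T b (T c x) = T (b * c) x`,
and `b * c` is the integral of `k.π (f s) (k.U s c)`. Applying the bounded map `T (·) x` under the
integral and using `inducedRep_apply` twice turns the integrand into `ρ.π (f s) (ρ.U s (T c x))`. -/
theorem rep_eq_integrated {X : Type*} [NormedAddCommGroup X] [NormedSpace 𝕜 X] [CompleteSpace X]
    (hB : HasBoundedApproxLeftIdentity B) {k : ContCovRep D B}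
    (hkA : ∀ a, k.π a ∈ leftCentralizer 𝕜 B) (hkG : ∀ r, k.U r ∈ leftCentralizer 𝕜 B)
    {ρ : ContCovRep D X} {T : B →ₙₐ[𝕜] (X →L[𝕜] X)} {hc : Continuous T} {hT : IsNondegenerate T}
    (hA : ∀ a, inducedRep hB T hc hT ⟨k.π a, hkA a⟩ = ρ.π a)
    (hG : ∀ r, inducedRep hB T hc hT ⟨k.U r, hkG r⟩ = ρ.U r)
    {f : C_c(G, A)} {b : B} (hb : k.integrated μ f = leftRegular 𝕜 B b) :
    T b = ρ.integrated μ f := by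
  let T' : B →L[𝕜] (X →L[𝕜] X) :=
    { toFun := T, map_add' := map_add T, map_smul' := map_smul T, cont := hc }
  refine hT.ext fun c x => ?_
  rw [← mul_apply_eq_comp, ← map_mul, ← leftRegular_apply (𝕜 := 𝕜), ← hb]
  refine (clm_vint (T'.flip x) (k.continuous_integrand f c)
    (k.hasCompactSupport_integrand f c)).trans (vint_congr fun s => ?_)
  change T (k.π (f s) (k.U s c)) x = _
  rw [← hA, ← hG, inducedRep_apply, inducedRep_apply]

end Induced

/-! ### Extending maps from `C_c(G, A)` to the crossed product. -/

section Extension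

variable {𝕜 : Type*} [RCLike 𝕜]
  {A : Type u} [NonUnitalNormedRing A] [NormedSpace 𝕜 A] [IsScalarTower 𝕜 A A]
  [SMulCommClass 𝕜 A A] [CompleteSpace A]
  {G : Type v} [Group G] [TopologicalSpace G] [IsTopologicalGroup G] [LocallyCompactSpace G]
  [MeasurableSpace G] [BorelSpace G] {D : DynamicalSystem 𝕜 A G} (μ : Measure G)
  [μ.IsHaarMeasure] (R : UniformlyBoundedClass.{u, v, w} D)

namespace CrossedProduct

theorem exists_extension {Y : Type*} [NormedAddCommGroup Y] [NormedSpace 𝕜 Y] [CompleteSpace Y]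
    (F : C_c(G, A) →ₗ[𝕜] Y) (hF : ∃ c : ℝ, ∀ f, ‖F f‖ ≤ c * R.sigma μ f) :
    ∃ Ψ : CrossedProduct μ R →L[𝕜] Y, ∀ f, Ψ (q μ R f) = F f :=
  ⟨F.extendOfNorm (q μ R), LinearMap.extendOfNorm_eq (denseRange_q μ R)
    (hF.imp fun c hc f => by rw [norm_q]; exact hc f)⟩

/-- A bounded map on the crossed product that dominates `σ` is bounded below. -/
theorem norm_le_of_sigma_le {Y : Type*} [NormedAddCommGroup Y] [NormedSpace 𝕜 Y]
    (Ψ : CrossedProduct μ R →L[𝕜] Y) {c : ℝ} (h : ∀ f, R.sigma μ f ≤ c * ‖Ψ (q μ R f)‖)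
    (z : CrossedProduct μ R) : ‖z‖ ≤ c * ‖Ψ z‖ :=
  induction_on μ R (p := fun z => ‖z‖ ≤ c * ‖Ψ z‖) z
    (isClosed_le continuous_norm (Ψ.continuous.norm.const_smul c)) fun f => by
      rw [norm_q]; exact h f

/-- The upper bound lets `F` extend continuously. The lower bound makes the extension injective with
closed range, and density of the range of `F` then gives surjectivity. Multiplicativity passes to
the completion by continuity. -/
theorem exists_topAlgEquiv {B : Type*} [NonUnitalNormedRing B] [NormedSpace 𝕜 B]
    [CompleteSpace B] (F : C_c(G, A) →ₗ[𝕜] B)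
    (hmul : ∀ f g, F (conv D μ f g) = F f * F g) (hd : DenseRange F)
    (hF : ∃ c : ℝ, ∀ f, ‖F f‖ ≤ c * R.sigma μ f)
    (hF' : ∃ c : ℝ, 0 ≤ c ∧ ∀ f, R.sigma μ f ≤ c * ‖F f‖) :
    ∃ ψ : TopAlgEquiv 𝕜 (CrossedProduct μ R) B,
      ∀ f, ψ.toContinuousLinearEquiv (q μ R f) = F f := by
  obtain ⟨Ψ, hΨ⟩ := exists_extension μ R F hF
  obtain ⟨c, hc0, hc⟩ := hF'
  have hanti : AntilipschitzWith ⟨c, hc0⟩ Ψ :=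
    Ψ.antilipschitz_of_bound
      (norm_le_of_sigma_le μ R Ψ fun f => by rw [hΨ]; exact hc f)
  have hcl : IsClosed (Set.range Ψ) := hanti.isClosed_range Ψ.uniformContinuous
  have hsub : Set.range F ⊆ Set.range Ψ := by
    rintro _ ⟨f, rfl⟩
    exact ⟨_, hΨ f⟩
  have hsurj : Function.Surjective Ψ := fun b => closure_minimal hsub hcl (hd b)
  let e := ContinuousLinearEquiv.ofBijective Ψ (LinearMap.ker_eq_bot.2 hanti.injective)
    (LinearMap.range_eq_top.2 hsurj)
  have hmulΨ : ∀ x y, Ψ (x * y) = Ψ x * Ψ y := fun x y => by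
    refine induction_on μ R (p := fun x => Ψ (x * y) = Ψ x * Ψ y) x
      (isClosed_eq (by fun_prop) (by fun_prop)) fun f => ?_
    refine induction_on μ R (p := fun y => Ψ (q μ R f * y) = Ψ (q μ R f) * Ψ y) y
      (isClosed_eq (by fun_prop) (by fun_prop)) fun g => ?_
    rw [← q_mul, hΨ, hΨ, hΨ, hmul]
  exact ⟨⟨e, hmulΨ⟩, hΨ⟩

/-- An isomorphism intertwining the canonical pair with a covariant representation `k` carries
left multiplication by `q f` to the integrated form of `k`, provided the crossed product has a
faithful representation integrating some covariant representation. -/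
theorem mul_eq_integrated {B : Type*} [NonUnitalNormedRing B] [NormedSpace 𝕜 B]
    [IsScalarTower 𝕜 B B] [SMulCommClass 𝕜 B B] [CompleteSpace B] {k : ContCovRep D B}
    {X : Type*} [NormedAddCommGroup X] [NormedSpace 𝕜 X] [CompleteSpace X] {τ : ContCovRep D X}
    {P : CrossedProduct μ R →L[𝕜] (X →L[𝕜] X)} (hP : Function.Injective P)
    (hPq : ∀ f, P (q μ R f) = τ.integrated μ f)
    (ψ : TopAlgEquiv 𝕜 (CrossedProduct μ R) B)
    (hA : ∀ a, k.π a = (ψ.leftCentralizerCongr (iA μ R a) : B →L[𝕜] B))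
    (hG : ∀ r, k.U r = (ψ.leftCentralizerCongr (iG μ R r) : B →L[𝕜] B))
    (f : C_c(G, A)) (b : B) :
    ψ.toContinuousLinearEquiv (q μ R f) * b = k.integrated μ f b := by
  set e := ψ.toContinuousLinearEquiv with he
  have hdense : DenseRange fun g => e (q μ R g) :=
    e.surjective.denseRange.comp (denseRange_q μ R) e.continuous
  refine hdense.induction_on b
    (isClosed_eq (by fun_prop) (by fun_prop)) fun g => ?_
  rw [← ψ.map_mul, ← q_mul]
  apply e.symm.injective
  rw [e.symm_apply_apply]
  -- Passing to operators on `X` through the injective `P` replaces an integral in the crossed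
  -- product by the defining integral of `τ`; both sides become the integral of `τ.π (f s) (τ.U s
  -- (τ.integrated μ g x))`.
  apply hP
  ext x
  rw [hPq, τ.integrated_conv, mul_apply_eq_comp]
  let W : B →L[𝕜] X := (P.flip x).comp (e.symm : B →L[𝕜] CrossedProduct μ R)
  refine Eq.trans ?_ (clm_vint W (k.continuous_integrand f (e (q μ R g)))
    (k.hasCompactSupport_integrand f _)).symm
  refine vint_congr fun s => ?_
  change _ = P (e.symm (k.π (f s) (k.U s (e (q μ R g))))) x
  rw [hG, TopAlgEquiv.leftCentralizerCongr_apply, ← he, e.symm_apply_apply, iG_q, hA,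
    TopAlgEquiv.leftCentralizerCongr_apply, ← he, e.symm_apply_apply, e.symm_apply_apply, iA_q,
    hPq, τ.integrated_actA, τ.integrated_actG]
  rfl

end CrossedProduct

end Extension

end BanachCrossedProduct

/-! ### The theorem. -/

open BanachCrossedProduct
theorem mainTheorem3 {𝕜 : Type*} [RCLike 𝕜]
    {A : Type u} [NonUnitalNormedRing A] [NormedSpace 𝕜 A] [IsScalarTower 𝕜 A A]
    [SMulCommClass 𝕜 A A] [CompleteSpace A]
    {G : Type v} [Group G] [TopologicalSpace G] [IsTopologicalGroup G] [LocallyCompactSpace G]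
    [T2Space G] [MeasurableSpace G] [BorelSpace G] (μ : Measure G) [μ.IsHaarMeasure]
    (D : DynamicalSystem 𝕜 A G) (hA : HasBoundedApproxLeftIdentity A)
    (R : UniformlyBoundedClass.{u, v, w} D) (hR : R.AllNondegenerate)
    {B : Type x} [NonUnitalNormedRing B] [NormedSpace 𝕜 B] [IsScalarTower 𝕜 B B]
    [SMulCommClass 𝕜 B B] [CompleteSpace B] (hB : HasBoundedApproxLeftIdentity B)
    (hlam : IsEmbedding (leftRegular 𝕜 B))
    (k : ContCovRep D B) (hk : IsNondegenerate k.π) (hkR : R.IsContinuousFor μ k)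
    (hkA : ∀ a, k.π a ∈ leftCentralizer 𝕜 B) (hkG : ∀ r, k.U r ∈ leftCentralizer 𝕜 B)
    (hsub : ∀ f : C_c(G, A), ∃ b : B, k.integrated μ f = leftRegular 𝕜 B b)
    (hdense : ∀ b : B, (leftRegular 𝕜 B b : B →L[𝕜] B) ∈ closure (Set.range (k.integrated μ)))
    (hgen : ∀ (X : Type (max u v w)) [NormedAddCommGroup X] [NormedSpace 𝕜 X] [CompleteSpace X]
      (ρ : ContCovRep D X), IsNondegenerate ρ.π → R.IsContinuousFor μ ρ →
      ∃ (T : B →ₙₐ[𝕜] (X →L[𝕜] X)) (hTc : Continuous T) (hTn : IsNondegenerate T),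
        (∀ a, inducedRep hB T hTc hTn ⟨k.π a, hkA a⟩ = ρ.π a) ∧
        (∀ r, inducedRep hB T hTc hTn ⟨k.U r, hkG r⟩ = ρ.U r)) :
    ∃! ψ : TopAlgEquiv 𝕜 (CrossedProduct μ R) B,
      (∀ a, (⟨k.π a, hkA a⟩ : leftCentralizer 𝕜 B) =
        ψ.leftCentralizerCongr (CrossedProduct.iA μ R a)) ∧
      (∀ r, (⟨k.U r, hkG r⟩ : leftCentralizer 𝕜 B) =
        ψ.leftCentralizerCongr (CrossedProduct.iG μ R r)) := by

  obtain ⟨X, _, _, _, τ, hτ, hτR, hτn⟩ := R.exists_norming μ hR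
  obtain ⟨T, hTc, hTn, hTA, hTG⟩ := hgen X τ hτ hτR
  choose Φ hΦ using hsub
  have hTΦ : ∀ f, T (Φ f) = τ.integrated μ f := fun f =>
    rep_eq_integrated μ hB hkA hkG hTA hTG (hΦ f)
  have hinj : ∀ b c : B, (leftRegular 𝕜 B b : B →L[𝕜] B) = leftRegular 𝕜 B c → b = c :=
    fun b c h => hlam.injective (Subtype.ext h)
  -- Linearity and multiplicativity of `Φ` are inherited from the integrated form by cancelling the
  -- injective `λ`.
  let F : C_c(G, A) →ₗ[𝕜] B :=
    { toFun := Φ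
      map_add' := fun f g => hinj _ _ (by rw [← hΦ, map_add, map_add, hΦ, hΦ]; rfl)
      map_smul' := fun c f => hinj _ _ (by rw [← hΦ, map_smul, map_smul, hΦ]; rfl) }
  have hF : ∀ f, k.integrated μ f = leftRegular 𝕜 B (F f) := hΦ
  have hmul : ∀ f g, F (conv D μ f g) = F f * F g := fun f g =>
    hinj _ _ (by rw [← hF, k.integrated_conv, map_mul, hF, hF]; rfl)
  have hd : DenseRange F := fun b => by
    have hi : IsInducing fun b => (leftRegular 𝕜 B b : B →L[𝕜] B) :=
      IsInducing.subtypeVal.comp hlam.isInducing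
    -- Since `λ` is inducing, density of `F` in `B` is density of `λ ∘ F`, the integrated form of
    -- `k`, in `λ(B)`.
    rw [hi.closure_eq_preimage_closure_image, ← Set.range_comp, Set.mem_preimage]
    convert hdense b using 3
    exact funext fun f => (hF f).symm
  have hup : ∃ c : ℝ, ∀ f, ‖F f‖ ≤ c * R.sigma μ f := by
    obtain ⟨c, hc0, hc⟩ := exists_norm_le_leftRegular hlam
    obtain ⟨M, hM⟩ := hkR
    refine ⟨c * M, fun f => (hc _).trans ?_⟩
    rw [mul_assoc]
    refine mul_le_mul_of_nonneg_left ?_ hc0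
    have := hM f
    rwa [hF] at this
  -- `σ(f) ≤ 2 ‖τ(f)‖ = 2 ‖T (F f)‖ ≤ 2 K ‖F f‖`.
  have hlow : ∃ c : ℝ, 0 ≤ c ∧ ∀ f, R.sigma μ f ≤ c * ‖F f‖ := by
    obtain ⟨K, hK0, hK⟩ := exists_norm_le hTc
    refine ⟨2 * K, by positivity, fun f => (hτn f).trans ?_⟩
    rw [mul_assoc, ← hTΦ]
    exact mul_le_mul_of_nonneg_left (hK _) zero_le_two
  obtain ⟨ψ, hψ⟩ := CrossedProduct.exists_topAlgEquiv μ R F hmul hd hup hlow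
  -- `P` extends the integrated form of `τ`; being bounded below by `hτn` it is injective, which the
  -- uniqueness part needs.
  obtain ⟨P, hP⟩ := CrossedProduct.exists_extension μ R (τ.integrated μ) hτR
  have hPinj : Function.Injective P := (injective_iff_map_eq_zero P).2 fun z hz => by
    have := CrossedProduct.norm_le_of_sigma_le μ R P (fun f => by rw [hP]; exact hτn f) z
    rw [hz, norm_zero, mul_zero] at this
    exact norm_le_zero_iff.1 this
  refine ⟨ψ, ⟨fun a => Subtype.ext (ContinuousLinearMap.ext fun b => ?_),
    fun r => Subtype.ext (ContinuousLinearMap.ext fun b => ?_)⟩, ?_⟩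
  · rw [TopAlgEquiv.leftCentralizerCongr_apply]
    refine hd.induction_on b (isClosed_eq (by fun_prop) (by fun_prop)) fun f => ?_
    rw [← hψ, ContinuousLinearEquiv.symm_apply_apply, CrossedProduct.iA_q, hψ, hψ]
    refine hinj _ _ ?_
    -- After applying `λ` the claim is `k.π a ∘ λ (F f) = λ (k.π a (F f))`, which is the left
    -- centralizer property of `k.π a`.
    rw [← hF, k.integrated_actA, hF]
    ext c
    exact (hkA a _ _).symm
  · rw [TopAlgEquiv.leftCentralizerCongr_apply]
    refine hd.induction_on b (isClosed_eq (by fun_prop) (by fun_prop)) fun f => ?_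
    rw [← hψ, ContinuousLinearEquiv.symm_apply_apply, CrossedProduct.iG_q, hψ, hψ]
    refine hinj _ _ ?_
    rw [← hF, k.integrated_actG, hF]
    ext c
    exact (hkG r _ _).symm
  · rintro ψ' ⟨hA', hG'⟩
    -- `λ (ψ' (q f))` is the integrated form of `k` at `f`, that is `λ (F f)`; injectivity of `λ`
    -- fixes `ψ'` on the range of `q`.
    have hq : ∀ f, ψ'.toContinuousLinearEquiv (CrossedProduct.q μ R f) = F f := fun f => by
      refine hinj _ _ (ContinuousLinearMap.ext fun b => ?_)
      rw [← hF]
      exact CrossedProduct.mul_eq_integrated μ R hPinj hP ψ'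
        (fun a => congrArg Subtype.val (hA' a)) (fun r => congrArg Subtype.val (hG' r)) f b
    have heq : ψ'.toContinuousLinearEquiv = ψ.toContinuousLinearEquiv := by
      ext z
      exact CrossedProduct.induction_on μ R z (isClosed_eq (by fun_prop) (by fun_prop))
        fun f => (hq f).trans (hψ f).symm
    cases ψ'
    cases ψ
    congr
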